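/- Let $k$ be a field and, for $n\ge 0$, let $S=k[x_1,\dots,x_n]$. A squarefree monomial ideal of $S$ is an ideal generated by squarefree monomials (the zero ideal and the unit ideal are included). For a homogeneous ideal $I\subseteq S$ let $I_d$ be the $k$-vector space of degree $d$ forms in $I$, and let $\mathbf m_1I_d$ be the $k$-span of all products $x_if$ with $1\le i\le n$ and $f\in I_d$. A homogeneous ideal $I$ is called Gotzmann if, for every degree $d$ and every homogeneous ideal $J\subseteq S$ with $\dim_k I_d=\dim_k J_d$, one has $\dim_k\mathbf m_1I_d\le\dim_k\mathbf m_1J_d$. For every $n\ge 0$ the number $g_n$ of squarefree Gotzmann monomial ideals of $k[x_1,\dots,x_n]$ is finite, and the exponential generating function of these numbers is, as a formal power series over $\mathbb{Q}$, $$\sum_{n\ge 0} g_n\frac{t^n}{n!}=e^t\left(\frac{2(1-t)}{2-e^t}+t\right).$$ In particular $g_0,g_1,g_2,g_3,g_4,g_5$ are $2,3,6,19,96,669$ respectively. -/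

import Mathlib

open MvPolynomial

attribute [local instance] MvPolynomial.gradedAlgebra

/-- The component `I_d`: the `k`-vector space of degree `d` forms in the ideal `I`. -/
noncomputable def gradedPiece {k : Type*} [Field k] {n : ℕ} (I : Ideal (MvPolynomial (Fin n) k)) (d : ℕ) :
    Submodule k (MvPolynomial (Fin n) k) :=
  I.restrictScalars k ⊓ homogeneousSubmodule (Fin n) k d

/-- The space `𝐦₁ V` spanned by all products `xᵢ f` of a variable and an element `f` of `V`. -/
noncomputable def mOneMul {k : Type*} [Field k] {n : ℕ} (V : Submodule k (MvPolynomial (Fin n) k)) :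
    Submodule k (MvPolynomial (Fin n) k) :=
  Submodule.span k {g | ∃ i : Fin n, ∃ f ∈ V, g = X i * f}

/-- A homogeneous ideal `I` is Gotzmann if, in each degree `d`, its component `I_d` has minimal
growth among the components `J_d` of the same dimension of all homogeneous ideals `J`. -/
def IsGotzmann {k : Type*} [Field k] {n : ℕ} (I : Ideal (MvPolynomial (Fin n) k)) : Prop :=
  I.IsHomogeneous (homogeneousSubmodule (Fin n) k) ∧
  ∀ (d : ℕ) (J : Ideal (MvPolynomial (Fin n) k)),
    J.IsHomogeneous (homogeneousSubmodule (Fin n) k) →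
    Module.finrank k (gradedPiece I d) = Module.finrank k (gradedPiece J d) →
    Module.finrank k (mOneMul (gradedPiece I d)) ≤ Module.finrank k (mOneMul (gradedPiece J d))

/-- A squarefree (monomial) ideal: an ideal generated by a set of squarefree monomials. The zero
ideal (no generators) and the unit ideal (generated by the monomial `1`) are squarefree. -/
def IsSquarefreeMonomialIdeal {k : Type*} [Field k] {n : ℕ}
    (I : Ideal (MvPolynomial (Fin n) k)) : Prop :=
  ∃ A : Set (Fin n →₀ ℕ), (∀ a ∈ A, ∀ i, a i ≤ 1) ∧
    I = Ideal.span ((fun a => monomial a (1 : k)) '' A)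

/-- The set of squarefree Gotzmann ideals of `k[x₁, …, xₙ]`. -/
def squarefreeGotzmannIdeals (k : Type*) [Field k] (n : ℕ) :
    Set (Ideal (MvPolynomial (Fin n) k)) :=
  {I | IsSquarefreeMonomialIdeal I ∧ IsGotzmann I}

/-- The exponential generating function `∑ aₙ tⁿ / n!` of a sequence, as a formal power series. -/
noncomputable def exponentialGeneratingFunction (a : ℕ → ℕ) : PowerSeries ℚ :=
  PowerSeries.mk fun n => (a n : ℚ) / (n.factorial : ℚ)

/-!
Squarefree Gotzmann ideals are classified by the supports of their minimal generators, and the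
classification is then counted.

*Reduction to monomials.* Passing to leading monomials shows that a squarefree ideal is Gotzmann if
and only if, for every `e`, its monomials of degree `e` have the smallest possible upper shadow
among the sets of monomials of degree `e` of the same size (`isGotzmann_sqfreeIdeal_iff`).

*Macaulay's theorem.* Compression in two variables turns a set of monomials into a strongly stable
one without enlarging its upper shadow (`exists_stronglyStable`). For strongly stable sets,
induction on the number of variables, with Green's bound for the deletion of the last variable,
gives the lower bound `macaulay_le_card_upShadow`. Sizes are written as sums of numbers of
monomials of blocks, the `t`-th block being generated in degree `d t` over the variables from the
`t`-th on. Every size is of this form and the bound is sharp (`exists_macaulay_eq`,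
`exists_attains`).

*The classification.* Multiplying an ideal by a new variable and adding a new variable as a
generator preserve the equality in Macaulay's bound, so the chain families, built by these two
operations from the zero ideal and the unit ideal, give Gotzmann ideals
(`ChainFamily.minimalGrowth`). Conversely, let a proper nonzero squarefree ideal be Gotzmann. In
large degrees its Hilbert function is a sum of blocks with fixed degrees `d t`. The Hilbert
function of a squarefree ideal is a polynomial in all positive degrees. So is the sum of the blocks
with `d t` at most the current degree: removing a generator of top degree `E` loses `E` monomials
of the next degree, which bounds the number of blocks, and then the polynomials counting the blocks
vanish in the positive degrees below `d t`. Hence the `d t` represent the Hilbert function in all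
degrees (`exists_degrees`), they are the degrees of the minimal generators, and the `t`-th
generator has at most `n - t` new multiples by variables. As each earlier generator makes at most
one variable redundant, each of them makes exactly one redundant, distinct ones for distinct
generators, and this forces a chain family (`chainFamily_of_colon`).

*Counting.* Splitting off the variables that are generators writes the number of chain families in
`n` variables as `1 + ∑ₘ C(n, m) a(m)`, where `a` counts the proper ideals containing no variable.
Splitting off the common factor writes it in the same way with `b` in place of `a`, where `b`
counts the nonzero ideals without a common variable. So `a = b`. Every ideal except the `n` ideals
`(xᵢ)` is counted by exactly one of `a(n)` and `b(n)`, so that the number of ideals is `2 a(n) + n`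
(`card_chainFamilies`), and `a(n) = 1 - n + ∑_{m < n} C(n, m) a(m)`. For the exponential generating
function `A` of `a` this reads `A (2 - eᵗ) = eᵗ (1 - t)`, and the series of the numbers of ideals
is `2 A + t eᵗ`.
-/

namespace SquarefreeGotzmann

/-! ### Fibres in two variables -/

section Monomials

variable {α : Type*}

/-- Two monomials lie in the same `(i, j)`-fibre if they have the same exponents outside `i, j`
and the same total exponent in `i, j`. -/
def SameFiber (i j : α) (u v : α →₀ ℕ) : Prop :=
  v i + v j = u i + u j ∧ ∀ l, l ≠ i → l ≠ j → v l = u l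

theorem SameFiber.symm {i j : α} {u v : α →₀ ℕ} (h : SameFiber i j u v) : SameFiber i j v u :=
  ⟨h.1.symm, fun l h1 h2 => (h.2 l h1 h2).symm⟩

theorem SameFiber.trans {i j : α} {u v w : α →₀ ℕ} (h : SameFiber i j u v)
    (h' : SameFiber i j v w) : SameFiber i j u w :=
  ⟨h'.1.trans h.1, fun l h1 h2 => (h'.2 l h1 h2).trans (h.2 l h1 h2)⟩

theorem SameFiber.refl (i j : α) (u : α →₀ ℕ) : SameFiber i j u u := ⟨rfl, fun _ _ _ => rfl⟩

theorem SameFiber.eq_of_eq {i j : α} {u v : α →₀ ℕ} (h : SameFiber i j u v) (hj : v j = u j) :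
    v = u := by
  ext l
  by_cases hl : l = j
  · rw [hl, hj]
  by_cases hl' : l = i
  · have := h.1
    rw [hl']
    omega
  · exact h.2 l hl' hl

open Classical in
/-- The members of `B` in the `(i, j)`-fibre of `u`. -/
noncomputable def fiber (i j : α) (B : Finset (α →₀ ℕ)) (u : α →₀ ℕ) : Finset (α →₀ ℕ) :=
  B.filter (SameFiber i j u)

theorem mem_fiber {i j : α} {B : Finset (α →₀ ℕ)} {u v : α →₀ ℕ} :
    v ∈ fiber i j B u ↔ v ∈ B ∧ SameFiber i j u v := by
  simp [fiber]

theorem SameFiber.fiber_eq {i j : α} {B : Finset (α →₀ ℕ)} {u v : α →₀ ℕ}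
    (h : SameFiber i j u v) : fiber i j B u = fiber i j B v := by
  ext w
  simp only [mem_fiber]
  exact ⟨fun hw => ⟨hw.1, h.symm.trans hw.2⟩, fun hw => ⟨hw.1, h.trans hw.2⟩⟩

/-- The position of `u` in its fibre, ordered by the exponent of `j`. -/
noncomputable def fiberRank (i j : α) (B : Finset (α →₀ ℕ)) (u : α →₀ ℕ) : ℕ :=
  ((fiber i j B u).filter fun v => v j < u j).card

theorem injOn_fiber (i j : α) (B : Finset (α →₀ ℕ)) (u : α →₀ ℕ) :
    Set.InjOn (fun v : α →₀ ℕ => v j) (fiber i j B u) := by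
  intro v hv w hw h
  have hv' := (mem_fiber.1 (Finset.mem_coe.1 hv)).2
  have hw' := (mem_fiber.1 (Finset.mem_coe.1 hw)).2
  exact (hw'.symm.trans hv').eq_of_eq h

theorem fiberRank_le (i j : α) (B : Finset (α →₀ ℕ)) (u : α →₀ ℕ) :
    fiberRank i j B u ≤ u j := by
  have : ((fiber i j B u).filter fun v => v j < u j).card ≤ (Finset.range (u j)).card := by
    refine Finset.card_le_card_of_injOn (fun v => v j) ?_ ?_
    · intro v hv
      simpa using (Finset.mem_filter.1 hv).2
    · exact (injOn_fiber i j B u).mono (by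
        intro v hv
        exact (Finset.mem_filter.1 (Finset.mem_coe.1 hv)).1)
  simpa [fiberRank] using this

theorem fiberRank_lt_card {i j : α} {B : Finset (α →₀ ℕ)} {u : α →₀ ℕ} (hu : u ∈ B) :
    fiberRank i j B u < (fiber i j B u).card := by
  refine Finset.card_lt_card (Finset.filter_ssubset.2 ⟨u, ?_, lt_irrefl _⟩)
  exact mem_fiber.2 ⟨hu, SameFiber.refl i j u⟩

theorem fiberRank_lt {i j : α} {B : Finset (α →₀ ℕ)} {u v : α →₀ ℕ} (hu : u ∈ B)
    (h : SameFiber i j u v) (huv : u j < v j) : fiberRank i j B u < fiberRank i j B v := by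
  rw [fiberRank, fiberRank, h.fiber_eq]
  refine Finset.card_lt_card ?_
  rw [Finset.ssubset_iff_of_subset]
  · refine ⟨u, ?_, by simp⟩
    exact Finset.mem_filter.2 ⟨mem_fiber.2 ⟨hu, h.symm⟩, huv⟩
  · intro w hw
    obtain ⟨h1, h2⟩ := Finset.mem_filter.1 hw
    exact Finset.mem_filter.2 ⟨h1, h2.trans huv⟩

theorem fiberRank_injOn {i j : α} {B : Finset (α →₀ ℕ)} {u v : α →₀ ℕ} (hu : u ∈ B) (hv : v ∈ B)
    (h : SameFiber i j u v) (huv : fiberRank i j B u = fiberRank i j B v) : u = v := by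
  rcases lt_trichotomy (u j) (v j) with h1 | h1 | h1
  · exact absurd huv (fiberRank_lt hu h h1).ne
  · exact (h.symm.eq_of_eq h1)
  · exact absurd huv (fiberRank_lt hv h.symm h1).ne'

/-- Push `u` down inside its fibre: the exponent of `j` becomes the rank of `u`, and the excess
moves to `i`. -/
noncomputable def push (i j : α) (B : Finset (α →₀ ℕ)) (u : α →₀ ℕ) : α →₀ ℕ :=
  u + Finsupp.single i (u j - fiberRank i j B u) - Finsupp.single j (u j - fiberRank i j B u)

theorem push_apply_right {i j : α} (hij : i ≠ j) (B : Finset (α →₀ ℕ)) (u : α →₀ ℕ) :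
    push i j B u j = fiberRank i j B u := by
  have := fiberRank_le i j B u
  simp [push, hij]
  omega

theorem push_add {i j : α} (B : Finset (α →₀ ℕ)) (u : α →₀ ℕ) :
    push i j B u + Finsupp.single j (u j - fiberRank i j B u) =
      u + Finsupp.single i (u j - fiberRank i j B u) := by
  rw [push, tsub_add_cancel_of_le]
  refine le_trans (fun l => ?_) le_self_add
  by_cases h : j = l
  · subst h
    simp
  · simp [h]

theorem sameFiber_push {i j : α} (hij : i ≠ j) (B : Finset (α →₀ ℕ)) (u : α →₀ ℕ) :
    SameFiber i j u (push i j B u) := by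
  have := fiberRank_le i j B u
  refine ⟨?_, fun l h1 h2 => ?_⟩
  · rw [push_apply_right hij]
    simp [push, hij.symm]
    omega
  · simp [push, h1.symm, h2.symm]

theorem push_injOn {i j : α} (hij : i ≠ j) (B : Finset (α →₀ ℕ)) :
    Set.InjOn (push i j B) B := by
  intro u hu v hv h
  have h1 := sameFiber_push hij B u
  have h2 := sameFiber_push hij B v
  rw [← h] at h2
  refine fiberRank_injOn hu hv (h1.trans h2.symm) ?_
  rw [← push_apply_right hij, h, push_apply_right hij]

theorem degree_push {i j : α} (B : Finset (α →₀ ℕ)) (u : α →₀ ℕ) :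
    (push i j B u).degree = u.degree := by
  have := congrArg Finsupp.degree (push_add (i := i) (j := j) B u)
  rw [map_add, map_add, Finsupp.degree_single, Finsupp.degree_single] at this
  omega

/-- The weight of a monomial for the weights `r` of the variables. -/
noncomputable def wt (r : α → ℕ) (u : α →₀ ℕ) : ℕ := Finsupp.weight r u

theorem wt_push {i j : α} (r : α → ℕ) (B : Finset (α →₀ ℕ)) (u : α →₀ ℕ) :
    wt r (push i j B u) + (u j - fiberRank i j B u) * r j =
      wt r u + (u j - fiberRank i j B u) * r i := by
  have := congrArg (Finsupp.weight r) (push_add (i := i) (j := j) B u)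
  rw [map_add, map_add, Finsupp.weight_single, Finsupp.weight_single] at this
  simpa only [wt, smul_eq_mul] using this

theorem wt_push_le {i j : α} {r : α → ℕ} (hr : r i < r j) (B : Finset (α →₀ ℕ)) (u : α →₀ ℕ) :
    wt r (push i j B u) ≤ wt r u := by
  have h1 := wt_push (i := i) (j := j) r B u
  have h2 := Nat.mul_le_mul_left (u j - fiberRank i j B u) hr.le
  omega

theorem wt_push_lt {i j : α} {r : α → ℕ} (hr : r i < r j) {B : Finset (α →₀ ℕ)} {u : α →₀ ℕ}
    (h : fiberRank i j B u < u j) : wt r (push i j B u) < wt r u := by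
  have h1 := wt_push (i := i) (j := j) r B u
  have h2 := Nat.mul_lt_mul_of_pos_left hr (Nat.sub_pos_of_lt h)
  omega

/-- Where `A` violates closure under replacing `j` by `i`, the rank is smaller than the exponent:
compression moves something. -/
theorem exists_fiberRank_lt {i j : α} (hij : i ≠ j) {A : Finset (α →₀ ℕ)} {v : α →₀ ℕ}
    (hi : v + Finsupp.single i 1 ∉ A) :
    fiberRank i j A (v + Finsupp.single j 1) <
      (v + Finsupp.single j 1 : α →₀ ℕ) j := by
  refine lt_of_le_of_ne (fiberRank_le _ _ _ _) fun h => hi ?_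
  set u := v + Finsupp.single j 1 with hu
  have hsurj : Set.SurjOn (fun w : α →₀ ℕ => w j)
      ((fiber i j A u).filter fun w => w j < u j) (Finset.range (u j)) := by
    refine Finset.surjOn_of_injOn_of_card_le _ ?_ ?_ (by simpa [fiberRank] using h.ge)
    · intro w hw
      simpa using (Finset.mem_filter.1 (Finset.mem_coe.1 hw)).2
    · exact (injOn_fiber i j A u).mono fun w hw =>
        (Finset.mem_filter.1 (Finset.mem_coe.1 hw)).1
  obtain ⟨w, hw, hwj⟩ := hsurj (Finset.mem_coe.2 (Finset.mem_range.2
    (show v j < u j by simp [hu])))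
  have hw := mem_fiber.1 (Finset.mem_filter.1 (Finset.mem_coe.1 hw)).1
  have : SameFiber i j u (v + Finsupp.single i 1) := by
    refine ⟨?_, fun l h1 h2 => ?_⟩
    · simp [hu, hij, hij.symm]
      omega
    · simp [hu, h1.symm, h2.symm]
  have heq : w = v + Finsupp.single i 1 := by
    refine (this.symm.trans hw.2).eq_of_eq ?_
    simpa [Finsupp.single_apply, hij] using hwj
  exact heq ▸ hw.1

/-! ### Monomials and upper shadows -/

variable [DecidableEq α]

/-- The monomials of degree `e` in the variables of `V`, as exponent vectors. -/
def monomials (V : Finset α) (e : ℕ) : Finset (α →₀ ℕ) := V.finsuppAntidiag e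

/-- The upper shadow of a set of monomials: all products of one of them with a variable of `V`. -/
noncomputable def upShadow (V : Finset α) (A : Finset (α →₀ ℕ)) : Finset (α →₀ ℕ) :=
  (V ×ˢ A).image fun p => p.2 + Finsupp.single p.1 1

theorem mem_monomials {V : Finset α} {e : ℕ} {u : α →₀ ℕ} :
    u ∈ monomials V e ↔ u.degree = e ∧ u.support ⊆ V := by
  rw [monomials, Finset.mem_finsuppAntidiag']
  rfl

theorem mem_upShadow {V : Finset α} {A : Finset (α →₀ ℕ)} {u : α →₀ ℕ} :
    u ∈ upShadow V A ↔ ∃ i ∈ V, ∃ v ∈ A, v + Finsupp.single i 1 = u := by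
  simp only [upShadow, Finset.mem_image, Finset.mem_product, Prod.exists]
  constructor
  · rintro ⟨i, v, ⟨hi, hv⟩, rfl⟩
    exact ⟨i, hi, v, hv, rfl⟩
  · rintro ⟨i, hi, v, hv, rfl⟩
    exact ⟨i, v, ⟨hi, hv⟩, rfl⟩

theorem add_single_mem_upShadow {V : Finset α} {A : Finset (α →₀ ℕ)} {v : α →₀ ℕ} {i : α}
    (hi : i ∈ V) (hv : v ∈ A) : v + Finsupp.single i 1 ∈ upShadow V A :=
  mem_upShadow.2 ⟨i, hi, v, hv, rfl⟩

theorem upShadow_mono {V : Finset α} {A B : Finset (α →₀ ℕ)} (h : A ⊆ B) :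
    upShadow V A ⊆ upShadow V B := by
  intro u hu
  obtain ⟨i, hi, v, hv, rfl⟩ := mem_upShadow.1 hu
  exact add_single_mem_upShadow hi (h hv)

theorem card_monomials (V : Finset α) (e : ℕ) :
    (monomials V e).card = V.card.multichoose e :=
  Finset.card_finsuppAntidiag_nat_eq_multichoose e

theorem add_single_mem_monomials {V : Finset α} {e : ℕ} {v : α →₀ ℕ} {i : α}
    (hi : i ∈ V) (hv : v ∈ monomials V e) : v + Finsupp.single i 1 ∈ monomials V (e + 1) := by
  obtain ⟨h1, h2⟩ := mem_monomials.1 hv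
  refine mem_monomials.2 ⟨by simp [h1], ?_⟩
  refine Finsupp.support_add.trans (Finset.union_subset h2 ?_)
  exact Finsupp.support_single_subset.trans (by simpa using hi)

theorem upShadow_subset_monomials {V : Finset α} {e : ℕ} {A : Finset (α →₀ ℕ)}
    (hA : A ⊆ monomials V e) : upShadow V A ⊆ monomials V (e + 1) := by
  intro u hu
  obtain ⟨i, hi, v, hv, rfl⟩ := mem_upShadow.1 hu
  exact add_single_mem_monomials hi (hA hv)

/-! ### Compression in two variables -/

/-- The compression of a set of monomials: every fibre is replaced by the initial segment of the
same size. -/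
noncomputable def compress (i j : α) (B : Finset (α →₀ ℕ)) : Finset (α →₀ ℕ) :=
  B.image (push i j B)

theorem card_compress {i j : α} (hij : i ≠ j) (B : Finset (α →₀ ℕ)) :
    (compress i j B).card = B.card :=
  Finset.card_image_of_injOn (push_injOn hij B)

theorem mem_compress {i j : α} (hij : i ≠ j) {B : Finset (α →₀ ℕ)} {u : α →₀ ℕ} :
    u ∈ compress i j B ↔ u j < (fiber i j B u).card := by
  constructor
  · intro hu
    obtain ⟨v, hv, rfl⟩ := Finset.mem_image.1 hu
    rw [push_apply_right hij, ← (sameFiber_push hij B v).fiber_eq]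
    exact fiberRank_lt_card hv
  · intro hu
    -- the ranks of the members of a fibre fill an initial segment of `ℕ`
    have hsurj : Set.SurjOn (fiberRank i j B) (fiber i j B u)
        (Finset.range (fiber i j B u).card) := by
      refine Finset.surjOn_of_injOn_of_card_le _ ?_ ?_ (by simp)
      · intro v hv
        have hv := mem_fiber.1 (Finset.mem_coe.1 hv)
        rw [hv.2.fiber_eq]
        simpa using fiberRank_lt_card hv.1
      · intro v hv w hw h
        have hv := mem_fiber.1 (Finset.mem_coe.1 hv)
        have hw := mem_fiber.1 (Finset.mem_coe.1 hw)
        exact fiberRank_injOn hv.1 hw.1 (hv.2.symm.trans hw.2) h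
    obtain ⟨v, hv, hvu⟩ := hsurj (Finset.mem_coe.2 (Finset.mem_range.2 hu))
    have hv := mem_fiber.1 (Finset.mem_coe.1 hv)
    refine Finset.mem_image.2 ⟨v, hv.1, ?_⟩
    refine (hv.2.trans (sameFiber_push hij B v)).eq_of_eq ?_
    rw [push_apply_right hij, hvu]

theorem compress_subset_monomials {i j : α} {V : Finset α} {e : ℕ} (hi : i ∈ V)
    {B : Finset (α →₀ ℕ)} (hB : B ⊆ monomials V e) : compress i j B ⊆ monomials V e := by
  intro u hu
  obtain ⟨v, hv, rfl⟩ := Finset.mem_image.1 hu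
  obtain ⟨h1, h2⟩ := mem_monomials.1 (hB hv)
  refine mem_monomials.2 ⟨(degree_push B v).trans h1, ?_⟩
  refine (Finsupp.support_mono (tsub_le_self)).trans (Finsupp.support_add.trans ?_)
  exact Finset.union_subset h2 (Finsupp.support_single_subset.trans (by simpa using hi))

theorem card_fiber_le_card_fiber_upShadow {i j l : α} {V : Finset α} (hl : l ∈ V)
    (B : Finset (α →₀ ℕ)) (u : α →₀ ℕ) :
    (fiber i j B u).card ≤ (fiber i j (upShadow V B) (u + Finsupp.single l 1)).card := by
  refine Finset.card_le_card_of_injOn (fun w => w + Finsupp.single l 1) ?_ ?_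
  · intro w hw
    have hw := mem_fiber.1 (Finset.mem_coe.1 hw)
    refine Finset.mem_coe.2 (mem_fiber.2 ⟨add_single_mem_upShadow hl hw.1, ?_, ?_⟩)
    · have := hw.2.1
      simp only [Finsupp.add_apply]
      omega
    · intro m h1 h2
      simp [hw.2.2 m h1 h2]
  · intro v _ w _ h
    simpa using h

/-- Multiplying a nonempty fibre by both `x_i` and `x_j` produces one more monomial. -/
theorem card_fiber_lt_card_fiber_upShadow {i j : α} (hij : i ≠ j) {V : Finset α} (hi : i ∈ V)
    (hj : j ∈ V) {B : Finset (α →₀ ℕ)} {u : α →₀ ℕ} (hne : (fiber i j B u).Nonempty) :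
    (fiber i j B u).card < (fiber i j (upShadow V B) (u + Finsupp.single j 1)).card := by
  obtain ⟨v, hv, hmax⟩ := (fiber i j B u).exists_max_image (fun w => w j) hne
  have hnot : v + Finsupp.single j 1 ∉
      (fiber i j B u).image fun w => w + Finsupp.single i 1 := by
    intro h
    obtain ⟨w, hw, h⟩ := Finset.mem_image.1 h
    have h1 := DFunLike.congr_fun h j
    have h2 := hmax w hw
    simp [hij] at h1
    omega
  have hcard : ((fiber i j B u).image fun w => w + Finsupp.single i 1).card =
      (fiber i j B u).card :=
    Finset.card_image_of_injective _ (add_left_injective _)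
  rw [← hcard, Nat.lt_iff_add_one_le, ← Finset.card_insert_of_notMem hnot]
  refine Finset.card_le_card (Finset.insert_subset ?_ ?_)
  · have hv := mem_fiber.1 hv
    refine mem_fiber.2 ⟨add_single_mem_upShadow hj hv.1, ?_, ?_⟩
    · have := hv.2.1
      simp only [Finsupp.add_apply]
      omega
    · intro m h1 h2
      simp [hv.2.2 m h1 h2]
  · intro w' hw'
    obtain ⟨w, hw, rfl⟩ := Finset.mem_image.1 hw'
    have hw := mem_fiber.1 hw
    refine mem_fiber.2 ⟨add_single_mem_upShadow hi hw.1, ?_, ?_⟩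
    · have := hw.2.1
      simp [hij, hij.symm]
      omega
    · intro m h1 h2
      simp [hw.2.2 m h1 h2, h1.symm, h2.symm]

theorem upShadow_compress_subset {i j : α} (hij : i ≠ j) {V : Finset α} (hi : i ∈ V) (hj : j ∈ V)
    (B : Finset (α →₀ ℕ)) :
    upShadow V (compress i j B) ⊆ compress i j (upShadow V B) := by
  intro u hu
  obtain ⟨l, hl, v, hv, rfl⟩ := mem_upShadow.1 hu
  rw [mem_compress hij] at hv ⊢
  by_cases h : l = j
  · subst h
    have := card_fiber_lt_card_fiber_upShadow hij hi hj
      (Finset.card_pos.1 (Nat.zero_lt_of_lt hv))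
    simp
    omega
  · have := card_fiber_le_card_fiber_upShadow (i := i) (j := j) hl B v
    simp [h]
    omega

theorem card_upShadow_compress_le {i j : α} (hij : i ≠ j) {V : Finset α} (hi : i ∈ V)
    (hj : j ∈ V) (B : Finset (α →₀ ℕ)) :
    (upShadow V (compress i j B)).card ≤ (upShadow V B).card :=
  (Finset.card_le_card (upShadow_compress_subset hij hi hj B)).trans_eq (card_compress hij _)

/-- A set of monomials is strongly stable if it is closed under replacing a variable by a smaller
one. -/
def StronglyStable [LinearOrder α] (V : Finset α) (A : Finset (α →₀ ℕ)) : Prop :=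
  ∀ i ∈ V, ∀ j ∈ V, i < j → ∀ v : α →₀ ℕ,
    v + Finsupp.single j 1 ∈ A → v + Finsupp.single i 1 ∈ A

/-- Repeated compression turns any set of monomials into a strongly stable one of the same size
whose upper shadow is not larger. -/
theorem exists_stronglyStable {α : Type*} [LinearOrder α] {V : Finset α} {e : ℕ}
    (A : Finset (α →₀ ℕ)) (hA : A ⊆ monomials V e) :
    ∃ B ⊆ monomials V e, StronglyStable V B ∧ B.card = A.card ∧
      (upShadow V B).card ≤ (upShadow V A).card := by
  set r : α → ℕ := fun l => (V.filter (· < l)).card with hr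
  induction h : ∑ u ∈ A, wt r u using Nat.strong_induction_on generalizing A with
  | _ s ih =>
    by_cases hS : StronglyStable V A
    · exact ⟨A, hA, hS, rfl, le_rfl⟩
    · simp only [StronglyStable, not_forall] at hS
      obtain ⟨i, hi, j, hj, hij, v, hv, hv'⟩ := hS
      have hrij : r i < r j := by
        refine Finset.card_lt_card ?_
        rw [Finset.ssubset_iff_of_subset]
        · exact ⟨i, by simp [hi, hij], by simp⟩
        · intro w hw
          obtain ⟨h1, h2⟩ := Finset.mem_filter.1 hw
          exact Finset.mem_filter.2 ⟨h1, h2.trans hij⟩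
      have hlt : ∑ u ∈ compress i j A, wt r u < s := by
        rw [compress, Finset.sum_image (push_injOn hij.ne A), ← h]
        exact Finset.sum_lt_sum (fun u _ => wt_push_le hrij A u)
          ⟨_, hv, wt_push_lt hrij (exists_fiberRank_lt hij.ne hv')⟩
      obtain ⟨B, h1, h2, h3, h4⟩ := ih _ hlt _ (compress_subset_monomials hi hA) rfl
      exact ⟨B, h1, h2, h3.trans (card_compress hij.ne A),
        h4.trans (card_upShadow_compress_le hij.ne hi hj A)⟩

end Monomials

/-! ### Macaulay representations -/

/-- The number of monomials of degree `j` in the `n - t` variables from the `t`-th on (counting from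
zero); it is `0` when there are no such variables, even for `j = 0`. -/
def blockCard (n t j : ℕ) : ℕ := if t < n then (n - t).multichoose j else 0

/-- The number of monomials of degree `e` in `n` variables in an ideal with a Stanley decomposition
whose `t`-th block, for `t < T`, is generated in degree `d t` over the variables from the `t`-th on.
Lexicographic ideals have such decompositions. -/
def macaulay (n e T : ℕ) (d : ℕ → ℕ) : ℕ := ∑ t ∈ Finset.range T, blockCard n t (e - d t)

theorem blockCard_zero_left (t j : ℕ) : blockCard 0 t j = 0 := by simp [blockCard]

theorem blockCard_of_lt {n t : ℕ} (h : t < n) (j : ℕ) :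
    blockCard n t j = (n - t).multichoose j := by simp [blockCard, h]

theorem blockCard_of_le {n t : ℕ} (h : n ≤ t) (j : ℕ) : blockCard n t j = 0 := by
  simp [blockCard, h.not_gt]

theorem blockCard_zero_right_of_lt {n t : ℕ} (h : t < n) : blockCard n t 0 = 1 := by
  simp [blockCard, h]

theorem blockCard_one_right (n t : ℕ) : blockCard n t 1 = n - t := by
  rcases lt_or_ge t n with h | h
  · simp [blockCard, h]
  · simp [blockCard, h.not_gt, Nat.sub_eq_zero_of_le h]

/-- Pascal's rule for the number of monomials. -/
theorem blockCard_succ (n t j : ℕ) :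
    blockCard (n + 1) t (j + 1) = blockCard (n + 1) t j + blockCard n t (j + 1) := by
  rcases lt_trichotomy t n with h | h | h
  · rw [blockCard_of_lt (by omega), blockCard_of_lt (by omega), blockCard_of_lt h,
      show n + 1 - t = (n - t) + 1 by omega, Nat.multichoose_succ_succ, add_comm]
  · subst h
    simp [blockCard]
  · rw [blockCard_of_le (by omega), blockCard_of_le (by omega), blockCard_of_le (by omega)]

theorem blockCard_succ_succ (n t j : ℕ) : blockCard (n + 1) (t + 1) j = blockCard n t j := by
  simp [blockCard]

theorem blockCard_le_succ (n t j : ℕ) : blockCard n t j ≤ blockCard (n + 1) t j := by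
  cases j with
  | zero => unfold blockCard; split_ifs <;> simp; omega
  | succ j => rw [blockCard_succ]; omega

theorem macaulay_zero_left (e T : ℕ) (d : ℕ → ℕ) : macaulay 0 e T d = 0 := by
  simp [macaulay, blockCard_zero_left]

theorem macaulay_zero_terms (n e : ℕ) (d : ℕ → ℕ) : macaulay n e 0 d = 0 := by simp [macaulay]

theorem macaulay_succ_terms (n e T : ℕ) (d : ℕ → ℕ) :
    macaulay n e (T + 1) d = macaulay n e T d + blockCard n T (e - d T) :=
  Finset.sum_range_succ _ _

theorem macaulay_le_succ (n e T : ℕ) (d : ℕ → ℕ) : macaulay n e T d ≤ macaulay (n + 1) e T d :=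
  Finset.sum_le_sum fun _ _ => blockCard_le_succ _ _ _

theorem macaulay_congr {n e e' T : ℕ} {d d' : ℕ → ℕ} (h : ∀ t < T, e - d t = e' - d' t) :
    macaulay n e T d = macaulay n e' T d' :=
  Finset.sum_congr rfl fun t ht => by rw [h t (Finset.mem_range.1 ht)]

theorem macaulay_succ_succ {n e T : ℕ} {d : ℕ → ℕ} (h : ∀ t < T, d t ≤ e) :
    macaulay (n + 1) (e + 1) T d = macaulay (n + 1) e T d + macaulay n (e + 1) T d := by
  rw [macaulay, macaulay, macaulay, ← Finset.sum_add_distrib]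
  refine Finset.sum_congr rfl fun t ht => ?_
  rw [Nat.succ_sub (h t (Finset.mem_range.1 ht)), Nat.succ_eq_add_one, blockCard_succ]

theorem macaulay_cons (n e T : ℕ) (d : ℕ → ℕ) :
    macaulay (n + 1) e (T + 1) d =
      (n + 1).multichoose (e - d 0) + macaulay n e T fun t => d (t + 1) := by
  rw [macaulay, Finset.sum_range_succ', macaulay, add_comm]
  simp [blockCard_succ_succ, blockCard_of_lt]

theorem macaulay_split {n e T T₀ : ℕ} (d : ℕ → ℕ) (h : T₀ ≤ T) :
    macaulay n e T d = macaulay n e T₀ d + ∑ t ∈ Finset.Ico T₀ T, blockCard n t (e - d t) := by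
  rw [macaulay, macaulay, Finset.sum_range_add_sum_Ico _ h]

/-- A monotone sequence of degrees passes the threshold `e` once. -/
theorem exists_threshold (T : ℕ) {d : ℕ → ℕ} (hd : Monotone d) (e : ℕ) :
    ∃ T₀ ≤ T, (∀ t < T₀, d t < e) ∧ ∀ t, T₀ ≤ t → t < T → e ≤ d t := by
  induction T with
  | zero => exact ⟨0, le_rfl, by omega, by omega⟩
  | succ T ih =>
    obtain ⟨T₀, h1, h2, h3⟩ := ih
    by_cases h : d T < e
    · exact ⟨T + 1, le_rfl, fun t ht => (hd (Nat.lt_succ_iff.1 ht)).trans_lt h, by omega⟩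
    · refine ⟨T₀, by omega, h2, fun t ht ht' => ?_⟩
      rcases Nat.lt_succ_iff_lt_or_eq.1 ht' with h' | rfl
      · exact h3 t ht h'
      · omega

/-! ### Macaulay's lower bound for the upper shadow -/

section Stable

variable {α : Type*}

/-- The members of `A` not divisible by the variable `m`. -/
noncomputable def deletion (m : α) (A : Finset (α →₀ ℕ)) : Finset (α →₀ ℕ) :=
  A.filter fun u => u m = 0

theorem mem_deletion {m : α} {A : Finset (α →₀ ℕ)} {v : α →₀ ℕ} :
    v ∈ deletion m A ↔ v ∈ A ∧ v m = 0 := by simp [deletion]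

variable [LinearOrder α]

/-- The quotients by the variable `m` of the members of `A` divisible by it. -/
noncomputable def link (m : α) (A : Finset (α →₀ ℕ)) : Finset (α →₀ ℕ) :=
  (A.filter fun u => u m ≠ 0).image fun u => u - Finsupp.single m 1

theorem mem_link {m : α} {A : Finset (α →₀ ℕ)} {v : α →₀ ℕ} :
    v ∈ link m A ↔ v + Finsupp.single m 1 ∈ A := by
  simp only [link, Finset.mem_image, Finset.mem_filter]
  constructor
  · rintro ⟨u, ⟨hu, hm⟩, rfl⟩
    rwa [tsub_add_cancel_of_le]
    intro l
    by_cases h : m = l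
    · subst h; simpa using Nat.one_le_iff_ne_zero.2 hm
    · simp [h]
  · intro h
    exact ⟨_, ⟨h, by simp⟩, by simp⟩

theorem card_deletion_add_card_link (m : α) (A : Finset (α →₀ ℕ)) :
    (deletion m A).card + (link m A).card = A.card := by
  rw [deletion, link, Finset.card_image_of_injOn, Finset.card_filter_add_card_filter_not]
  intro u hu v hv h
  have hu : u m ≠ 0 := (Finset.mem_filter.1 (Finset.mem_coe.1 hu)).2
  have hv : v m ≠ 0 := (Finset.mem_filter.1 (Finset.mem_coe.1 hv)).2
  ext l
  have := DFunLike.congr_fun h l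
  by_cases hl : m = l
  · subst hl
    simp at this
    omega
  · simpa [hl] using this

theorem deletion_subset_monomials {m : α} {V : Finset α} {e : ℕ} {A : Finset (α →₀ ℕ)}
    (hA : A ⊆ monomials (insert m V) e) : deletion m A ⊆ monomials V e := by
  intro u hu
  obtain ⟨hu, hm⟩ := mem_deletion.1 hu
  obtain ⟨h1, h2⟩ := mem_monomials.1 (hA hu)
  refine mem_monomials.2 ⟨h1, fun l hl => ?_⟩
  rcases Finset.mem_insert.1 (h2 hl) with rfl | h
  · exact absurd hm (Finsupp.mem_support_iff.1 hl)
  · exact h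

theorem link_subset_monomials {m : α} {V : Finset α} {e : ℕ} {A : Finset (α →₀ ℕ)}
    (hA : A ⊆ monomials V (e + 1)) : link m A ⊆ monomials V e := by
  intro u hu
  obtain ⟨h1, h2⟩ := mem_monomials.1 (hA (mem_link.1 hu))
  refine mem_monomials.2 ⟨by simpa using h1, (Finsupp.support_mono ?_).trans h2⟩
  exact le_self_add

theorem link_eq_empty {m : α} {V : Finset α} {A : Finset (α →₀ ℕ)}
    (hA : A ⊆ monomials V 0) : link m A = ∅ := by
  refine Finset.eq_empty_of_forall_notMem fun u hu => ?_
  obtain ⟨h1, h2⟩ := mem_monomials.1 (hA (mem_link.1 hu))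
  simp at h1

theorem StronglyStable.deletion {m : α} {V : Finset α} (hm : m ∉ V) {A : Finset (α →₀ ℕ)}
    (hA : StronglyStable (insert m V) A) : StronglyStable V (deletion m A) := by
  intro i hi j hj hij v hv
  obtain ⟨h1, h2⟩ := mem_deletion.1 hv
  refine mem_deletion.2 ⟨hA i (by simp [hi]) j (by simp [hj]) hij v h1, ?_⟩
  have him : i ≠ m := fun h => hm (h ▸ hi)
  have : v m = 0 := by
    simp at h2
    exact h2.1
  simp [this, him]

theorem StronglyStable.link {m : α} {V : Finset α} {A : Finset (α →₀ ℕ)}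
    (hA : StronglyStable V A) : StronglyStable V (link m A) := by
  intro i hi j hj hij v hv
  rw [mem_link, add_right_comm] at hv ⊢
  exact hA i hi j hj hij _ hv

/-- Multiplying by the last variable `m`, and multiplying the members free of `m` by the other
variables, produces different monomials. -/
theorem card_add_card_upShadow_deletion_le {m : α} {V : Finset α} (hm : m ∉ V)
    (A : Finset (α →₀ ℕ)) :
    A.card + (upShadow V (deletion m A)).card ≤ (upShadow (insert m V) A).card := by
  rw [← Finset.card_image_of_injective A (add_left_injective (Finsupp.single m 1)),
    ← Finset.card_union_of_disjoint]
  · refine Finset.card_le_card (Finset.union_subset ?_ ?_)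
    · intro u hu
      obtain ⟨v, hv, rfl⟩ := Finset.mem_image.1 hu
      exact add_single_mem_upShadow (Finset.mem_insert_self m V) hv
    · intro u hu
      obtain ⟨i, hi, v, hv, rfl⟩ := mem_upShadow.1 hu
      exact add_single_mem_upShadow (Finset.mem_insert_of_mem hi) (mem_deletion.1 hv).1
  · refine Finset.disjoint_left.2 fun u hu hu' => ?_
    obtain ⟨v, hv, rfl⟩ := Finset.mem_image.1 hu
    obtain ⟨i, hi, w, hw, h⟩ := mem_upShadow.1 hu'
    have him : i ≠ m := fun h => hm (h ▸ hi)
    have h1 := DFunLike.congr_fun h m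
    simp [him, (mem_deletion.1 hw).2] at h1

theorem upShadow_deletion_link_subset {m : α} {V : Finset α} (hm : ∀ l ∈ V, l < m)
    {A : Finset (α →₀ ℕ)} (hA : StronglyStable (insert m V) A) :
    upShadow V (deletion m (link m A)) ⊆ deletion m A := by
  intro u hu
  obtain ⟨i, hi, v, hv, rfl⟩ := mem_upShadow.1 hu
  obtain ⟨h1, h2⟩ := mem_deletion.1 hv
  refine mem_deletion.2 ⟨hA i (by simp [hi]) m (by simp) (hm i hi) v (mem_link.1 h1), ?_⟩
  simp [h2, (hm i hi).ne]

/-- Green's bound for strongly stable sets: deleting the last variable leaves at least as many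
monomials as for the lexicographic segment of the same size. It is deduced from the bound on
upper shadows in fewer variables, by comparing the sizes of the deletion and of the link. -/
theorem macaulay_le_card_deletion {m : α} {V : Finset α} (hm : ∀ l ∈ V, l < m)
    (hV : ∀ (e T : ℕ) (d : ℕ → ℕ), Monotone d → (∀ t < T, d t ≤ e) →
      ∀ A ⊆ monomials V e, StronglyStable V A →
        macaulay V.card e T d ≤ A.card → macaulay V.card (e + 1) T d ≤ (upShadow V A).card)
    (e T : ℕ) (d : ℕ → ℕ) (hd : Monotone d) (hde : ∀ t < T, d t ≤ e) (A : Finset (α →₀ ℕ))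
    (hA : A ⊆ monomials (insert m V) e) (hS : StronglyStable (insert m V) A)
    (hcard : macaulay (V.card + 1) e T d ≤ A.card) :
    macaulay V.card e T d ≤ (deletion m A).card := by
  have hmV : m ∉ V := fun h => lt_irrefl _ (hm m h)
  have hsum := card_deletion_add_card_link m A
  induction e generalizing T d A with
  | zero =>
    rw [link_eq_empty hA, Finset.card_empty] at hsum
    have := macaulay_le_succ V.card 0 T d
    omega
  | succ e ih =>
    by_contra! hlt
    set n := V.card with hn
    obtain ⟨T₀, hT₀, hlow, hhigh⟩ := exists_threshold T hd (e + 1)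
    -- a bound for the link in degree `e` passes to its deletion, by induction on the degree, and
    -- from there to the deletion of `A`, which contains the upper shadow of the deletion of
    -- the link
    have key : ∀ (T' : ℕ) (d' : ℕ → ℕ), Monotone d' → (∀ t < T', d' t ≤ e) →
        macaulay (n + 1) e T' d' ≤ (link m A).card →
        macaulay n (e + 1) T' d' ≤ (deletion m A).card := by
      intro T' d' hd' hde' hc
      have hL := link_subset_monomials (m := m) hA
      have h1 := ih T' d' hd' hde' (link m A) hL hS.link hc
        (card_deletion_add_card_link m _)
      have h2 := hV e T' d' hd' hde' _ (deletion_subset_monomials hL) (hS.link.deletion hmV) h1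
      exact h2.trans (Finset.card_le_card (upShadow_deletion_link_subset hm hS))
    have hlow' : ∀ t < T₀, d t ≤ e := fun t ht => Nat.lt_succ_iff.1 (hlow t ht)
    -- the blocks generated in degree `e + 1` contribute at most one monomial each
    have hone : ∀ N, ∑ t ∈ Finset.Ico T₀ T, blockCard N t (e + 1 - d t) =
        ∑ t ∈ Finset.Ico T₀ T, blockCard N t 0 := fun N =>
      Finset.sum_congr rfl fun t ht => by
        obtain ⟨h1, h2⟩ := Finset.mem_Ico.1 ht
        rw [Nat.sub_eq_zero_of_le (hhigh t h1 h2)]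
    have hle : ∑ t ∈ Finset.Ico T₀ T, blockCard n t 0 ≤
        ∑ t ∈ Finset.Ico T₀ T, blockCard (n + 1) t 0 :=
      Finset.sum_le_sum fun _ _ => blockCard_le_succ _ _ _
    have hsmall : ∑ t ∈ Finset.Ico T₀ T, blockCard n t 0 ≤ n - T₀ := by
      calc ∑ t ∈ Finset.Ico T₀ T, blockCard n t 0
          = ((Finset.Ico T₀ T).filter (· < n)).card := by
            rw [Finset.card_filter]
            exact Finset.sum_congr rfl fun t _ => by simp [blockCard]
        _ ≤ (Finset.Ico T₀ n).card := Finset.card_le_card fun t ht => by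
            simp only [Finset.mem_filter, Finset.mem_Ico] at ht ⊢
            omega
        _ = n - T₀ := by simp
    rw [macaulay_split d hT₀, hone] at hcard hlt
    rw [macaulay_succ_succ hlow'] at hcard
    rcases lt_or_ge n T₀ with h | h
    · have := key T₀ d hd hlow' (by omega)
      omega
    · -- If the deletion is too small, then the link has a monomial more than the blocks below the
      -- threshold account for, so a block generated in degree `e` may be appended to them; in
      -- degree `e + 1` and without the last variable this block has `n - T₀` monomials, too many.
      set d' : ℕ → ℕ := fun t => if t < T₀ then d t else e with hd'
      have hmono : Monotone d' := by
        intro a b hab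
        simp only [hd']
        split_ifs with h1 h2 h2
        · exact hd hab
        · exact hlow' a h1
        · omega
        · exact le_rfl
      have hsame : ∀ N E, macaulay N E T₀ d' = macaulay N E T₀ d := fun N E =>
        macaulay_congr fun t ht => by simp [hd', ht]
      have hlast : d' T₀ = e := by simp [hd']
      have := key (T₀ + 1) d' hmono (fun t ht => by
        simp only [hd']
        split_ifs with h1
        · exact hlow' t h1
        · exact le_rfl) (by
          rw [macaulay_succ_terms, hsame, hlast, Nat.sub_self,
            blockCard_zero_right_of_lt (by omega)]
          omega)
      rw [macaulay_succ_terms, hsame, hlast, Nat.add_sub_cancel_left, blockCard_one_right] at this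
      omega

theorem StronglyStable.macaulay_le_card_upShadow (V : Finset α) :
    ∀ (e T : ℕ) (d : ℕ → ℕ), Monotone d → (∀ t < T, d t ≤ e) →
      ∀ A ⊆ monomials V e, StronglyStable V A →
        macaulay V.card e T d ≤ A.card → macaulay V.card (e + 1) T d ≤ (upShadow V A).card := by
  induction V using Finset.induction_on_max with
  | empty =>
    intro e T d _ _ A _ _ _
    simp [macaulay_zero_left]
  | insert m V hm ih =>
    intro e T d hd hde A hA hS hcard
    have hmV : m ∉ V := fun h => lt_irrefl _ (hm m h)
    rw [Finset.card_insert_of_notMem hmV] at hcard ⊢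
    have h1 := macaulay_le_card_deletion hm ih e T d hd hde A hA hS hcard
    have h2 := ih e T d hd hde _ (deletion_subset_monomials hA) (hS.deletion hmV) h1
    have h3 := card_add_card_upShadow_deletion_le hmV A
    rw [macaulay_succ_succ hde]
    omega

/-- **Macaulay's theorem** on the growth of sets of monomials. -/
theorem macaulay_le_card_upShadow {V : Finset α} {e T : ℕ} {d : ℕ → ℕ} (hd : Monotone d)
    (hde : ∀ t < T, d t ≤ e) {A : Finset (α →₀ ℕ)} (hA : A ⊆ monomials V e)
    (hcard : macaulay V.card e T d ≤ A.card) :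
    macaulay V.card (e + 1) T d ≤ (upShadow V A).card := by
  obtain ⟨B, h1, h2, h3, h4⟩ := exists_stronglyStable A hA
  exact (h2.macaulay_le_card_upShadow V e T d hd hde B h1 (h3 ▸ hcard)).trans h4

end Stable

/-! ### Every size has a Macaulay representation, and the bound is attained -/

/-- The sequence `a, d 0, d 1, …`. -/
def consSeq (a : ℕ) (d : ℕ → ℕ) : ℕ → ℕ
  | 0 => a
  | t + 1 => d t

theorem monotone_consSeq {a : ℕ} {d : ℕ → ℕ} (hd : Monotone d) (h : ∀ t, a ≤ d t) :
    Monotone (consSeq a d) := by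
  refine monotone_nat_of_le_succ fun t => ?_
  cases t with
  | zero => exact h 0
  | succ t => exact hd (Nat.le_succ t)

/-- Every size from one to the number of monomials has a representation, with a last block generated
in the current degree. It is the one read off from the last monomial of the lexicographic segment of
size `N`. -/
theorem exists_macaulay_eq (n : ℕ) : ∀ e N : ℕ, 1 ≤ N → N ≤ n.multichoose (e + 1) →
    ∃ (T : ℕ) (d : ℕ → ℕ), Monotone d ∧ T < n ∧ (∀ t, 1 ≤ d t ∧ d t ≤ e + 1) ∧ d T = e + 1 ∧
      macaulay n (e + 1) (T + 1) d = N := by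
  induction n with
  | zero =>
    intro e N h1 h2
    rw [Nat.multichoose_zero_succ] at h2
    omega
  | succ n ihn =>
    intro e
    induction e with
    | zero =>
      intro N h1 h2
      rw [Nat.multichoose_one_right] at h2
      refine ⟨N - 1, fun _ => 1, monotone_const, by omega, fun _ => ⟨le_rfl, le_rfl⟩, rfl, ?_⟩
      rw [Nat.sub_add_cancel h1, macaulay,
        Finset.sum_congr rfl fun t ht => blockCard_zero_right_of_lt
          ((Finset.mem_range.1 ht).trans_le h2)]
      simp
    | succ e ihe =>
      intro N h1 h2
      by_cases h : N ≤ (n + 1).multichoose (e + 1)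
      · obtain ⟨T, d, hd, hT, hb, hl, hN⟩ := ihe N h1 h
        refine ⟨T, fun t => d t + 1, fun a b hab => Nat.succ_le_succ (hd hab), hT,
          fun t => ⟨Nat.le_add_left 1 _, Nat.succ_le_succ (hb t).2⟩, congrArg (· + 1) hl, ?_⟩
        rw [← hN]
        exact macaulay_congr fun t _ => by omega
      · rw [Nat.multichoose_succ_succ] at h2
        obtain ⟨T, d, hd, hT, hb, hl, hN⟩ := ihn (e + 1) (N - (n + 1).multichoose (e + 1))
          (by omega) (by omega)
        refine ⟨T + 1, consSeq 1 d, monotone_consSeq hd fun t => (hb t).1, by omega, ?_, hl, ?_⟩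
        · rintro (_ | t)
          · exact ⟨le_rfl, by simp [consSeq]⟩
          · exact hb t
        · rw [macaulay_cons, show (fun t => consSeq 1 d (t + 1)) = d from rfl, hN]
          simp only [consSeq, Nat.add_sub_cancel]
          omega

section Attained

variable {α : Type*} [DecidableEq α]

/-- `A` is a set of monomials of degree `e` whose size and growth are those prescribed by the
degrees `d t`, `t < T`. -/
structure Attains (V : Finset α) (e : ℕ) (A : Finset (α →₀ ℕ)) (T : ℕ) (d : ℕ → ℕ) : Prop where
  subset : A ⊆ monomials V e
  card : A.card = macaulay V.card e T d
  card_upShadow : (upShadow V A).card = macaulay V.card (e + 1) T d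

theorem attains_empty (V : Finset α) (e : ℕ) (d : ℕ → ℕ) : Attains V e ∅ 0 d :=
  ⟨Finset.empty_subset _, by simp [macaulay_zero_terms],
    by simp [macaulay_zero_terms, upShadow]⟩

theorem upShadow_image_add_single (V : Finset α) (x : α) (A : Finset (α →₀ ℕ)) :
    upShadow V (A.image (· + Finsupp.single x 1)) =
      (upShadow V A).image (· + Finsupp.single x 1) := by
  ext u
  simp only [mem_upShadow, Finset.mem_image]
  constructor
  · rintro ⟨i, hi, _, ⟨v, hv, rfl⟩, rfl⟩
    exact ⟨_, ⟨i, hi, v, hv, rfl⟩, add_right_comm _ _ _⟩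
  · rintro ⟨_, ⟨i, hi, v, hv, rfl⟩, rfl⟩
    exact ⟨i, hi, _, ⟨v, hv, rfl⟩, add_right_comm _ _ _⟩

theorem card_image_add_single (x : α) (A : Finset (α →₀ ℕ)) :
    (A.image (· + Finsupp.single x 1)).card = A.card :=
  Finset.card_image_of_injective _ (add_left_injective _)

theorem Attains.mul {V : Finset α} {e : ℕ} {A : Finset (α →₀ ℕ)} {T : ℕ} {d : ℕ → ℕ}
    (h : Attains V e A T d) {x : α} (hx : x ∈ V) :
    Attains V (e + 1) (A.image (· + Finsupp.single x 1)) T fun t => d t + 1 := by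
  refine ⟨?_, ?_, ?_⟩
  · intro u hu
    obtain ⟨v, hv, rfl⟩ := Finset.mem_image.1 hu
    exact add_single_mem_monomials hx (h.subset hv)
  · rw [card_image_add_single, h.card]
    exact macaulay_congr fun t _ => by omega
  · rw [upShadow_image_add_single, card_image_add_single, h.card_upShadow]
    exact macaulay_congr fun t _ => by omega

theorem exists_add_single {V : Finset α} {e : ℕ} {u : α →₀ ℕ} (hu : u ∈ monomials V (e + 1)) :
    ∃ i ∈ V, ∃ v ∈ monomials V e, v + Finsupp.single i 1 = u := by
  obtain ⟨h1, h2⟩ := mem_monomials.1 hu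
  have hne : u ≠ 0 := by
    rintro rfl
    simp at h1
  obtain ⟨i, hi⟩ := Finsupp.support_nonempty_iff.2 hne
  have hle : Finsupp.single i 1 ≤ u := by
    intro l
    by_cases h : i = l
    · subst h
      simpa using Nat.one_le_iff_ne_zero.2 (Finsupp.mem_support_iff.1 hi)
    · simp [h]
  have hadd : u - Finsupp.single i 1 + Finsupp.single i 1 = u := tsub_add_cancel_of_le hle
  refine ⟨i, h2 hi, _, mem_monomials.2 ⟨?_, (Finsupp.support_mono tsub_le_self).trans h2⟩, hadd⟩
  have := congrArg Finsupp.degree hadd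
  rw [map_add, Finsupp.degree_single] at this
  omega

theorem monomials_mono {V W : Finset α} (h : V ⊆ W) (e : ℕ) : monomials V e ⊆ monomials W e :=
  fun _ hu => mem_monomials.2 ⟨(mem_monomials.1 hu).1, (mem_monomials.1 hu).2.trans h⟩

theorem apply_eq_zero_of_mem_monomials {V : Finset α} {e : ℕ} {u : α →₀ ℕ} {x : α}
    (hu : u ∈ monomials V e) (hx : x ∉ V) : u x = 0 :=
  Finsupp.notMem_support_iff.1 fun h => hx ((mem_monomials.1 hu).2 h)

theorem disjoint_image_add_single {V : Finset α} {e : ℕ} {A B : Finset (α →₀ ℕ)} {x : α}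
    (hA : A ⊆ monomials V e) (hx : x ∉ V) : Disjoint (B.image (· + Finsupp.single x 1)) A := by
  refine Finset.disjoint_left.2 fun u hu hu' => ?_
  obtain ⟨v, hv, rfl⟩ := Finset.mem_image.1 hu
  simpa using apply_eq_zero_of_mem_monomials (hA hu') hx

/-- All multiples of a new variable `x`, together with a set attaining the bound in the other
variables, attain the bound. -/
theorem Attains.add {V : Finset α} {e : ℕ} {A : Finset (α →₀ ℕ)} {T : ℕ} {d : ℕ → ℕ}
    (h : Attains V (e + 1) A T d) {x : α} (hx : x ∉ V) :
    Attains (insert x V) (e + 1)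
      ((monomials (insert x V) e).image (· + Finsupp.single x 1) ∪ A) (T + 1) (consSeq 1 d) := by
  have hup : upShadow (insert x V)
      ((monomials (insert x V) e).image (· + Finsupp.single x 1) ∪ A) =
      (monomials (insert x V) (e + 1)).image (· + Finsupp.single x 1) ∪ upShadow V A := by
    ext u
    constructor
    · intro hu
      obtain ⟨i, hi, v, hv, rfl⟩ := mem_upShadow.1 hu
      rcases Finset.mem_union.1 hv with hv | hvA
      · obtain ⟨w, hw, rfl⟩ := Finset.mem_image.1 hv
        exact Finset.mem_union_left _ (Finset.mem_image.2
          ⟨_, add_single_mem_monomials hi hw, add_right_comm _ _ _⟩)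
      · rcases Finset.mem_insert.1 hi with rfl | hi
        · exact Finset.mem_union_left _ (Finset.mem_image.2
            ⟨v, monomials_mono (Finset.subset_insert _ _) _ (h.subset hvA), rfl⟩)
        · exact Finset.mem_union_right _ (add_single_mem_upShadow hi hvA)
    · intro hu
      rcases Finset.mem_union.1 hu with hu | hu
      · obtain ⟨w, hw, rfl⟩ := Finset.mem_image.1 hu
        obtain ⟨i, hi, v, hv, rfl⟩ := exists_add_single hw
        exact mem_upShadow.2 ⟨i, hi, _, Finset.mem_union_left _ (Finset.mem_image.2 ⟨v, hv, rfl⟩),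
          add_right_comm _ _ _⟩
      · obtain ⟨i, hi, v, hv, rfl⟩ := mem_upShadow.1 hu
        exact add_single_mem_upShadow (Finset.mem_insert_of_mem hi) (Finset.mem_union_right _ hv)
  refine ⟨Finset.union_subset ?_ ?_, ?_, ?_⟩
  · intro u hu
    obtain ⟨v, hv, rfl⟩ := Finset.mem_image.1 hu
    exact add_single_mem_monomials (Finset.mem_insert_self _ _) hv
  · exact h.subset.trans (monomials_mono (Finset.subset_insert _ _) _)
  · rw [Finset.card_union_of_disjoint (disjoint_image_add_single h.subset hx),
      card_image_add_single, card_monomials, h.card, Finset.card_insert_of_notMem hx,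
      macaulay_cons]
    rfl
  · rw [hup, Finset.card_union_of_disjoint
      (disjoint_image_add_single (upShadow_subset_monomials h.subset) hx),
      card_image_add_single, card_monomials, h.card_upShadow, Finset.card_insert_of_notMem hx,
      macaulay_cons]
    rfl

theorem Attains.congr {V : Finset α} {e : ℕ} {A : Finset (α →₀ ℕ)} {T : ℕ} {d d' : ℕ → ℕ}
    (h : Attains V e A T d) (hd : ∀ t < T, d t = d' t) : Attains V e A T d' :=
  ⟨h.subset, h.card.trans (macaulay_congr fun t ht => by rw [hd t ht]),
    h.card_upShadow.trans (macaulay_congr fun t ht => by rw [hd t ht])⟩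

/-- Macaulay's bound is attained for every sequence of degrees. -/
theorem exists_attains (V : Finset α) : ∀ (e T : ℕ) (d : ℕ → ℕ), Monotone d →
    (∀ t < T, 1 ≤ d t ∧ d t ≤ e) → ∃ A, Attains V e A T d := by
  induction V using Finset.induction_on with
  | empty =>
    intro e T d _ _
    exact ⟨∅, Finset.empty_subset _, by simp [macaulay_zero_left],
      by simp [macaulay_zero_left, upShadow]⟩
  | insert x V hx ihV =>
    intro e
    induction e with
    | zero =>
      intro T d _ h
      rcases Nat.eq_zero_or_pos T with rfl | hT
      · exact ⟨∅, attains_empty _ _ _⟩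
      · have := h 0 hT
        omega
    | succ e ihe =>
      intro T d hd h
      rcases T with _ | T
      · exact ⟨∅, attains_empty _ _ _⟩
      by_cases h0 : d 0 = 1
      · obtain ⟨A, hA⟩ := ihV (e + 1) T (fun t => d (t + 1)) (fun a b hab => hd (by omega))
          fun t ht => h (t + 1) (by omega)
        refine ⟨_, (hA.add hx).congr fun t _ => ?_⟩
        cases t with
        | zero => exact h0.symm
        | succ t => rfl
      · have h2 : ∀ t, 2 ≤ d t := fun t => by
          have := hd (Nat.zero_le t)
          have := (h 0 (by omega)).1
          omega
        obtain ⟨A, hA⟩ := ihe (T + 1) (fun t => d t - 1)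
          (fun a b hab => Nat.sub_le_sub_right (hd hab) 1) fun t ht => by
            have := h t ht
            have := h2 t
            constructor <;> omega
        refine ⟨_, (hA.mul (Finset.mem_insert_self x V)).congr fun t _ => ?_⟩
        have := h2 t
        omega

/-- `A` has the smallest upper shadow among the sets of `A.card` monomials of degree `e`. -/
def MinimalGrowth (V : Finset α) (e : ℕ) (A : Finset (α →₀ ℕ)) : Prop :=
  ∀ B ⊆ monomials V e, B.card = A.card → (upShadow V A).card ≤ (upShadow V B).card

theorem Attains.minimalGrowth {α : Type*} [LinearOrder α] {V : Finset α} {e : ℕ}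
    {A : Finset (α →₀ ℕ)} {T : ℕ} {d : ℕ → ℕ} (h : Attains V e A T d) (hd : Monotone d)
    (hde : ∀ t < T, d t ≤ e) : MinimalGrowth V e A := by
  intro B hB hcard
  rw [h.card_upShadow]
  exact macaulay_le_card_upShadow hd hde hB (by rw [hcard, h.card])

/-- A set of minimal growth meets Macaulay's bound. -/
theorem MinimalGrowth.card_upShadow {α : Type*} [LinearOrder α] {V : Finset α} {e : ℕ}
    {A : Finset (α →₀ ℕ)} {T : ℕ} {d : ℕ → ℕ} (h : MinimalGrowth V e A)
    (hA : A ⊆ monomials V e) (hd : Monotone d) (hde : ∀ t < T, 1 ≤ d t ∧ d t ≤ e)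
    (hcard : A.card = macaulay V.card e T d) :
    (upShadow V A).card = macaulay V.card (e + 1) T d := by
  obtain ⟨B, hB⟩ := exists_attains V e T d hd hde
  refine le_antisymm ?_ (macaulay_le_card_upShadow hd (fun t ht => (hde t ht).2) hA hcard.ge)
  rw [← hB.card_upShadow]
  exact h B hB.subset (hB.card.trans hcard.symm)

/-! ### Chain families -/

/-- The supports of the minimal generators of the squarefree ideals obtained from the zero ideal and
the unit ideal by multiplying with a new variable and by adding a new variable as a generator. The
ideals other than the unit ideal are those of the form
`m₁(x₁₁, …, x₁ᵣ) + m₁m₂(x₂₁, …, x₂ₛ) + ⋯` with all variables distinct. -/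
inductive ChainFamily : Finset (Finset α) → Prop
  | zero : ChainFamily ∅
  | unit : ChainFamily {∅}
  | mul (x : α) (𝒢 : Finset (Finset α)) (hx : ∀ g ∈ 𝒢, x ∉ g) (h : ChainFamily 𝒢) :
      ChainFamily (𝒢.image (insert x))
  | add (x : α) (𝒢 : Finset (Finset α)) (h0 : ∅ ∉ 𝒢) (hx : ∀ g ∈ 𝒢, x ∉ g)
      (h : ChainFamily 𝒢) : ChainFamily (insert {x} 𝒢)

/-- The monomials of degree `e` in the ideal generated by the squarefree monomials with supports
in `𝒢`. -/
noncomputable def idealMonomials (V : Finset α) (𝒢 : Finset (Finset α)) (e : ℕ) :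
    Finset (α →₀ ℕ) :=
  (monomials V e).filter fun u => ∃ g ∈ 𝒢, g ⊆ u.support

theorem mem_idealMonomials {V : Finset α} {𝒢 : Finset (Finset α)} {e : ℕ} {u : α →₀ ℕ} :
    u ∈ idealMonomials V 𝒢 e ↔ u ∈ monomials V e ∧ ∃ g ∈ 𝒢, g ⊆ u.support := by
  simp [idealMonomials]

theorem idealMonomials_subset (V : Finset α) (𝒢 : Finset (Finset α)) (e : ℕ) :
    idealMonomials V 𝒢 e ⊆ monomials V e := Finset.filter_subset _ _

theorem idealMonomials_empty (V : Finset α) (e : ℕ) : idealMonomials V ∅ e = ∅ := by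
  simp [idealMonomials]

theorem idealMonomials_degree_zero (V : Finset α) {𝒢 : Finset (Finset α)} (h : ∅ ∉ 𝒢) :
    idealMonomials V 𝒢 0 = ∅ := by
  refine Finset.eq_empty_of_forall_notMem fun u hu => ?_
  obtain ⟨h1, g, hg, hgu⟩ := mem_idealMonomials.1 hu
  have : u = 0 := (Finsupp.degree_eq_zero_iff u).1 (mem_monomials.1 h1).1
  subst this
  rw [Finsupp.support_zero, Finset.subset_empty] at hgu
  exact h (hgu ▸ hg)

theorem support_add_single (v : α →₀ ℕ) (x : α) :
    (v + Finsupp.single x 1).support = insert x v.support := by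
  ext l
  by_cases h : x = l
  · subst h
    simp
  · have h' : l ≠ x := fun h' => h h'.symm
    simp [h']

theorem idealMonomials_image_insert {V : Finset α} {𝒢 : Finset (Finset α)} {x : α} (hx : x ∈ V)
    (h : ∀ g ∈ 𝒢, x ∉ g) (e : ℕ) :
    idealMonomials V (𝒢.image (insert x)) (e + 1) =
      (idealMonomials V 𝒢 e).image (· + Finsupp.single x 1) := by
  ext u
  simp only [Finset.mem_image]
  constructor
  · intro hu
    obtain ⟨h1, g', hg', hgu⟩ := mem_idealMonomials.1 hu
    obtain ⟨g, hg, rfl⟩ := Finset.mem_image.1 hg'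
    have hxu := hgu (Finset.mem_insert_self x g)
    have hadd : u - Finsupp.single x 1 + Finsupp.single x 1 = u := by
      refine tsub_add_cancel_of_le fun l => ?_
      by_cases h : x = l
      · subst h
        simpa using Nat.one_le_iff_ne_zero.2 (Finsupp.mem_support_iff.1 hxu)
      · simp [h]
    refine ⟨_, mem_idealMonomials.2 ⟨mem_monomials.2 ⟨?_, ?_⟩, g, hg, ?_⟩, hadd⟩
    · have := congrArg Finsupp.degree hadd
      rw [map_add, Finsupp.degree_single, (mem_monomials.1 h1).1] at this
      omega
    · exact (Finsupp.support_mono tsub_le_self).trans (mem_monomials.1 h1).2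
    · intro l hl
      have hlx : x ≠ l := fun hxl => h g hg (hxl ▸ hl)
      have := Finsupp.mem_support_iff.1 (hgu (Finset.mem_insert_of_mem hl))
      simpa [hlx] using this
  · rintro ⟨v, hv, rfl⟩
    obtain ⟨h1, g, hg, hgu⟩ := mem_idealMonomials.1 hv
    refine mem_idealMonomials.2 ⟨add_single_mem_monomials hx h1, _,
      Finset.mem_image_of_mem _ hg, ?_⟩
    rw [support_add_single]
    exact Finset.insert_subset_insert x hgu

theorem idealMonomials_insert_singleton {V : Finset α} {𝒢 : Finset (Finset α)} {x : α} (e : ℕ) :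
    idealMonomials (insert x V) (insert {x} 𝒢) (e + 1) =
      (monomials (insert x V) e).image (· + Finsupp.single x 1) ∪
        idealMonomials V 𝒢 (e + 1) := by
  ext u
  rw [Finset.mem_union]
  constructor
  · intro hu
    obtain ⟨h1, h2⟩ := mem_idealMonomials.1 hu
    by_cases hxu : x ∈ u.support
    · left
      have : u ∈ idealMonomials (insert x V) (({∅} : Finset (Finset α)).image (insert x)) (e + 1) :=
        mem_idealMonomials.2 ⟨h1, insert x ∅, by simp, by simpa using hxu⟩
      rw [idealMonomials_image_insert (Finset.mem_insert_self x V) (by simp)] at this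
      exact Finset.image_subset_image (idealMonomials_subset _ _ _) this
    · right
      obtain ⟨g, hg, hgu⟩ := h2
      rcases Finset.mem_insert.1 hg with rfl | hg
      · exact absurd (hgu (Finset.mem_singleton_self x)) hxu
      · refine mem_idealMonomials.2 ⟨mem_monomials.2 ⟨(mem_monomials.1 h1).1, fun l hl => ?_⟩,
          g, hg, hgu⟩
        exact Finset.mem_of_mem_insert_of_ne ((mem_monomials.1 h1).2 hl)
          fun hlx => hxu (hlx ▸ hl)
  · rintro (hu | hu)
    · obtain ⟨v, hv, rfl⟩ := Finset.mem_image.1 hu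
      refine mem_idealMonomials.2 ⟨add_single_mem_monomials (Finset.mem_insert_self x V) hv, {x},
        Finset.mem_insert_self _ _, ?_⟩
      rw [support_add_single]
      simp
    · obtain ⟨h1, g, hg, hgu⟩ := mem_idealMonomials.1 hu
      exact mem_idealMonomials.2 ⟨monomials_mono (Finset.subset_insert _ _) _ h1, g,
        Finset.mem_insert_of_mem hg, hgu⟩

/-- The ideal of a chain family attains Macaulay's bound in every degree. The unit ideal is a
representation with a block generated in degree `0`, which needs at least one variable. -/
theorem ChainFamily.exists_attains {𝒢 : Finset (Finset α)} (h : ChainFamily 𝒢) :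
    ∀ (V : Finset α), (∀ g ∈ 𝒢, g ⊆ V) → (V.Nonempty ∨ ∅ ∉ 𝒢) → ∀ e, ∃ (T : ℕ) (d : ℕ → ℕ),
      Monotone d ∧ (∅ ∉ 𝒢 → ∀ t, 1 ≤ d t) ∧ (∀ t < T, d t ≤ e) ∧
        Attains V e (idealMonomials V 𝒢 e) T d := by
  induction h with
  | zero =>
    intro V _ _ e
    refine ⟨0, fun _ => 1, monotone_const, fun _ _ => le_rfl, by simp, ?_⟩
    rw [idealMonomials_empty]
    exact attains_empty _ _ _
  | unit =>
    intro V _ hV e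
    have hV : V.Nonempty := hV.resolve_right (by simp)
    have hall : idealMonomials V {∅} e = monomials V e := by simp [idealMonomials]
    have hup : upShadow V (monomials V e) = monomials V (e + 1) :=
      (upShadow_subset_monomials subset_rfl).antisymm fun u hu =>
        mem_upShadow.2 (exists_add_single hu)
    have hc : ∀ E, V.card.multichoose E = macaulay V.card E 1 fun _ => 0 := fun E => by
      rw [macaulay_succ_terms, macaulay_zero_terms, blockCard_of_lt (Finset.card_pos.2 hV)]
      simp
    refine ⟨1, fun _ => 0, monotone_const, by simp, by simp, ?_⟩
    rw [hall]
    exact ⟨subset_rfl, by rw [card_monomials, hc], by rw [hup, card_monomials, hc]⟩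
  | mul x 𝒢 hx h ih =>
    intro V hV _ e
    rcases 𝒢.eq_empty_or_nonempty with rfl | ⟨g, hg⟩
    · refine ⟨0, fun _ => 1, monotone_const, fun _ _ => le_rfl, by simp, ?_⟩
      rw [Finset.image_empty, idealMonomials_empty]
      exact attains_empty _ _ _
    have hxV : x ∈ V := hV _ (Finset.mem_image_of_mem _ hg) (Finset.mem_insert_self x g)
    cases e with
    | zero =>
      refine ⟨0, fun _ => 1, monotone_const, fun _ _ => le_rfl, by simp, ?_⟩
      rw [idealMonomials_degree_zero]
      · exact attains_empty _ _ _
      · simp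
    | succ e =>
      obtain ⟨T, d, hd, _, h2, h3⟩ := ih V (fun g hg =>
        (Finset.subset_insert x g).trans (hV _ (Finset.mem_image_of_mem _ hg)))
        (Or.inl ⟨x, hxV⟩) e
      refine ⟨T, fun t => d t + 1, fun a b hab => Nat.succ_le_succ (hd hab),
        fun _ t => Nat.succ_pos _, fun t ht => Nat.succ_le_succ (h2 t ht), ?_⟩
      rw [idealMonomials_image_insert hxV hx]
      exact h3.mul hxV
  | add x 𝒢 h0 hx h ih =>
    intro V hV _ e
    have h0' : ∅ ∉ insert {x} 𝒢 := by
      intro h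
      rcases Finset.mem_insert.1 h with h | h
      · exact Finset.singleton_ne_empty x h.symm
      · exact h0 h
    cases e with
    | zero =>
      refine ⟨0, fun _ => 1, monotone_const, fun _ _ => le_rfl, by simp, ?_⟩
      rw [idealMonomials_degree_zero _ h0']
      exact attains_empty _ _ _
    | succ e =>
      have hxV : x ∈ V := hV _ (Finset.mem_insert_self _ _) (Finset.mem_singleton_self x)
      obtain ⟨T, d, hd, h1, h2, h3⟩ := ih (V.erase x) (fun g hg l hl =>
        Finset.mem_erase.2 ⟨fun hlx => hx g hg (hlx ▸ hl), hV _ (Finset.mem_insert_of_mem hg) hl⟩)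
        (Or.inr h0) (e + 1)
      have := h3.add (Finset.notMem_erase x V)
      rw [← idealMonomials_insert_singleton,
        Finset.insert_erase hxV] at this
      refine ⟨T + 1, consSeq 1 d, monotone_consSeq hd (h1 h0), ?_, ?_, this⟩
      · rintro - (_ | t)
        · exact le_rfl
        · exact h1 h0 t
      · rintro (_ | t) ht
        · exact Nat.succ_pos e
        · exact h2 t (by omega)

theorem ChainFamily.minimalGrowth {α : Type*} [LinearOrder α] {𝒢 : Finset (Finset α)}
    (h : ChainFamily 𝒢) {V : Finset α} (hV : ∀ g ∈ 𝒢, g ⊆ V) (e : ℕ) :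
    MinimalGrowth V e (idealMonomials V 𝒢 e) := by
  rcases V.eq_empty_or_nonempty with rfl | hne
  · intro B _ _
    simp [upShadow]
  · obtain ⟨T, d, hd, _, h2, h3⟩ := h.exists_attains V hV (Or.inl hne) e
    exact h3.minimalGrowth hd h2

end Attained

/-! ### From ideals to sets of monomials -/

section Bridge

variable {k : Type*} [Field k] {n : ℕ}

theorem finrank_restrictSupport (A : Finset (Fin n →₀ ℕ)) :
    Module.finrank k (restrictSupport k (A : Set (Fin n →₀ ℕ))) = A.card := by
  rw [Module.finrank_eq_card_basis (basisRestrictSupport k (A : Set (Fin n →₀ ℕ)))]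
  simp

theorem mOneMul_restrictSupport (A : Finset (Fin n →₀ ℕ)) :
    mOneMul (restrictSupport k (A : Set (Fin n →₀ ℕ))) =
      restrictSupport k (upShadow Finset.univ A : Set (Fin n →₀ ℕ)) := by
  apply le_antisymm
  · refine Submodule.span_le.2 ?_
    rintro _ ⟨i, f, hf, rfl⟩
    simp only [SetLike.mem_coe, mem_restrictSupport_iff] at hf ⊢
    intro u hu
    rw [Finset.mem_coe, support_X_mul, Finset.mem_map] at hu
    obtain ⟨v, hv, rfl⟩ := hu
    have := add_single_mem_upShadow (Finset.mem_univ i) (hf hv)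
    simpa [add_comm] using this
  · rw [restrictSupport_eq_span]
    refine Submodule.span_le.2 ?_
    rintro _ ⟨u, hu, rfl⟩
    obtain ⟨i, -, v, hv, rfl⟩ := mem_upShadow.1 (Finset.mem_coe.1 hu)
    refine Submodule.subset_span ⟨i, monomial v 1, ?_, ?_⟩
    · exact (monomial_mem_restrictSupport k).2 (Or.inl hv)
    · rw [add_comm, X, monomial_mul, one_mul]

theorem gradedPiece_span_monomial (s : Set (Fin n →₀ ℕ)) (A : Finset (Fin n →₀ ℕ)) (d : ℕ)
    (hA : ∀ u, u ∈ A ↔ u.degree = d ∧ ∃ a ∈ s, a ≤ u) :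
    gradedPiece (Ideal.span ((fun a => monomial a (1 : k)) '' s)) d =
      restrictSupport k (A : Set (Fin n →₀ ℕ)) := by
  ext f
  rw [gradedPiece, Submodule.mem_inf, Submodule.restrictScalars_mem,
    mem_ideal_span_monomial_image, homogeneousSubmodule_eq_finsupp_supported,
    mem_restrictSupport_iff]
  constructor
  · rintro ⟨h1, h2⟩ u hu
    exact (hA u).2 ⟨h2 hu, h1 u hu⟩
  · intro h
    exact ⟨fun u hu => ((hA u).1 (h hu)).2, fun u hu => ((hA u).1 (h hu)).1⟩

theorem isHomogeneous_span_monomial (s : Set (Fin n →₀ ℕ)) :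
    (Ideal.span ((fun a => monomial a (1 : k)) '' s)).IsHomogeneous
      (homogeneousSubmodule (Fin n) k) := by
  refine Ideal.homogeneous_span _ _ ?_
  rintro _ ⟨a, _, rfl⟩
  exact ⟨a.degree, isHomogeneous_monomial _ rfl⟩

open Classical in
/-- The leading monomials, for the lexicographic order, of the forms of degree `d` in `W`. -/
noncomputable def leadingMonomials (W : Submodule k (MvPolynomial (Fin n) k)) (d : ℕ) :
    Finset (Fin n →₀ ℕ) :=
  (monomials Finset.univ d).filter fun u =>
    ∃ f ∈ W, f ≠ 0 ∧ (MonomialOrder.lex (σ := Fin n)).degree f = u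

theorem mem_leadingMonomials {W : Submodule k (MvPolynomial (Fin n) k)} {d : ℕ}
    {u : Fin n →₀ ℕ} : u ∈ leadingMonomials W d ↔ u ∈ monomials Finset.univ d ∧
      ∃ f ∈ W, f ≠ 0 ∧ (MonomialOrder.lex (σ := Fin n)).degree f = u := by
  simp [leadingMonomials]

theorem leadingMonomials_subset (W : Submodule k (MvPolynomial (Fin n) k)) (d : ℕ) :
    leadingMonomials W d ⊆ monomials Finset.univ d :=
  fun _ hu => (mem_leadingMonomials.1 hu).1

theorem degree_mem_leadingMonomials {W : Submodule k (MvPolynomial (Fin n) k)} {d : ℕ}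
    (hW : W ≤ homogeneousSubmodule (Fin n) k d) {f : MvPolynomial (Fin n) k} (hf : f ∈ W)
    (h0 : f ≠ 0) : (MonomialOrder.lex (σ := Fin n)).degree f ∈ leadingMonomials W d := by
  refine mem_leadingMonomials.2 ⟨mem_monomials.2 ⟨?_, Finset.subset_univ _⟩, f, hf, h0, rfl⟩
  by_contra h
  have h1 := (MonomialOrder.lex (σ := Fin n)).degree_mem_support h0
  exact (mem_support_iff.1 h1) (IsHomogeneous.coeff_eq_zero (hW hf) h)

theorem finiteDimensional_of_le_homogeneousSubmodule {W : Submodule k (MvPolynomial (Fin n) k)}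
    {d : ℕ} (hW : W ≤ homogeneousSubmodule (Fin n) k d) : FiniteDimensional k W := by
  have : FiniteDimensional k (homogeneousSubmodule (Fin n) k d) :=
    Module.Finite.of_fg (homogeneousSubmodule_fg (Fin n) k d)
  exact Submodule.finiteDimensional_of_le hW

/-- A space of forms has as many leading monomials as its dimension. -/
theorem card_leadingMonomials {W : Submodule k (MvPolynomial (Fin n) k)} {d : ℕ}
    (hW : W ≤ homogeneousSubmodule (Fin n) k d) :
    (leadingMonomials W d).card = Module.finrank k W := by
  have hfin := finiteDimensional_of_le_homogeneousSubmodule hW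
  classical
  set m := MonomialOrder.lex (σ := Fin n)
  apply le_antisymm
  · have hex : ∀ u : leadingMonomials W d, ∃ f ∈ W, f ≠ 0 ∧ m.degree f = u := fun u =>
      (mem_leadingMonomials.1 u.2).2
    choose f hfW hf0 hfu using hex
    have hli : LinearIndependent k fun u => (⟨f u, hfW u⟩ : W) := by
      rw [linearIndependent_iff']
      intro s g hg
      by_contra! hne
      -- the coefficient at the largest leading monomial that occurs does not cancel
      obtain ⟨u, hu, hmax⟩ := (s.filter fun u => g u ≠ 0).exists_max_image
        (fun u => m.toSyn u.1) (by
          obtain ⟨u, hu, h⟩ := hne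
          exact ⟨u, Finset.mem_filter.2 ⟨hu, h⟩⟩)
      obtain ⟨hus, hgu⟩ := Finset.mem_filter.1 hu
      have h1 := congrArg (fun w : W => coeff u.1 (w : MvPolynomial (Fin n) k)) hg
      simp only [Submodule.coe_sum, Submodule.coe_smul, coeff_sum, coeff_smul, smul_eq_mul,
        ZeroMemClass.coe_zero, coeff_zero] at h1
      rw [Finset.sum_eq_single u] at h1
      · rcases mul_eq_zero.1 h1 with h | h
        · exact hgu h
        · rw [← hfu u] at h
          exact hf0 u (m.coeff_degree_eq_zero_iff.1 h)
      · intro v hv hvu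
        by_cases hgv : g v = 0
        · rw [hgv, zero_mul]
        · have hle := hmax v (Finset.mem_filter.2 ⟨hv, hgv⟩)
          have hlt : m.toSyn v.1 < m.toSyn u.1 := lt_of_le_of_ne hle fun h =>
            hvu (Subtype.ext (m.toSyn.injective h))
          rw [m.coeff_eq_zero_of_lt (by rw [hfu]; exact hlt), mul_zero]
      · exact fun h => absurd hus h
    simpa using hli.fintype_card_le_finrank
  · let φ : W →ₗ[k] (leadingMonomials W d → k) :=
      LinearMap.pi fun u => (MvPolynomial.lcoeff k u.1).comp W.subtype
    have hφ : Function.Injective φ := by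
      rw [← LinearMap.ker_eq_bot, LinearMap.ker_eq_bot']
      intro f hf
      by_contra h0
      have h0' : (f : MvPolynomial (Fin n) k) ≠ 0 := fun h => h0 (Subtype.ext h)
      have := congrFun hf ⟨_, degree_mem_leadingMonomials hW f.2 h0'⟩
      exact h0' (m.coeff_degree_eq_zero_iff.1 this)
    have := LinearMap.finrank_le_finrank_of_injective hφ
    simpa using this

theorem mOneMul_le_homogeneousSubmodule {W : Submodule k (MvPolynomial (Fin n) k)} {d : ℕ}
    (hW : W ≤ homogeneousSubmodule (Fin n) k d) :
    mOneMul W ≤ homogeneousSubmodule (Fin n) k (d + 1) := by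
  refine Submodule.span_le.2 ?_
  rintro _ ⟨i, f, hf, rfl⟩
  rw [add_comm]
  exact (isHomogeneous_X k i).mul (hW hf)

/-- The inclusion may be strict: sums of products of variables and forms can have new leading
monomials. This is the direction of Macaulay's reduction to monomial ideals that is needed. -/
theorem upShadow_leadingMonomials_subset {W : Submodule k (MvPolynomial (Fin n) k)} {d : ℕ}
    (hW : W ≤ homogeneousSubmodule (Fin n) k d) :
    upShadow Finset.univ (leadingMonomials W d) ⊆ leadingMonomials (mOneMul W) (d + 1) := by
  intro u hu
  obtain ⟨i, -, v, hv, rfl⟩ := mem_upShadow.1 hu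
  obtain ⟨f, hf, h0, rfl⟩ := (mem_leadingMonomials.1 hv).2
  have h := degree_mem_leadingMonomials (mOneMul_le_homogeneousSubmodule hW)
    (f := X i * f) (Submodule.subset_span ⟨i, f, hf, rfl⟩) (mul_ne_zero (X_ne_zero i) h0)
  rwa [MonomialOrder.degree_mul (X_ne_zero i) h0, MonomialOrder.degree_X,
    add_comm (Finsupp.single i 1)] at h

theorem card_upShadow_leadingMonomials_le {W : Submodule k (MvPolynomial (Fin n) k)} {d : ℕ}
    (hW : W ≤ homogeneousSubmodule (Fin n) k d) :
    (upShadow Finset.univ (leadingMonomials W d)).card ≤ Module.finrank k (mOneMul W) :=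
  (Finset.card_le_card (upShadow_leadingMonomials_subset hW)).trans_eq
    (card_leadingMonomials (mOneMul_le_homogeneousSubmodule hW))

/-- The exponent vector of the squarefree monomial with support `g`. -/
noncomputable def sqfree {α : Type*} (g : Finset α) : α →₀ ℕ :=
  Finsupp.indicator g fun _ _ => 1

theorem sqfree_apply {α : Type*} [DecidableEq α] (g : Finset α) (i : α) :
    sqfree g i = if i ∈ g then 1 else 0 := by
  simp [sqfree, Finsupp.indicator_apply]

theorem support_sqfree {α : Type*} (g : Finset α) : (sqfree g).support = g := by
  classical
  ext i
  simp [sqfree_apply]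

theorem sqfree_le_iff {α : Type*} {g : Finset α} {u : α →₀ ℕ} :
    sqfree g ≤ u ↔ g ⊆ u.support := by
  classical
  constructor
  · intro h
    have := Finsupp.support_mono h
    rwa [support_sqfree] at this
  · intro h i
    rw [sqfree_apply]
    split_ifs with hi
    · exact Nat.one_le_iff_ne_zero.2 (Finsupp.mem_support_iff.1 (h hi))
    · exact Nat.zero_le _

variable (k) in
/-- The ideal generated by the squarefree monomials with supports in `𝒢`. -/
noncomputable def sqfreeIdeal (𝒢 : Finset (Finset (Fin n))) : Ideal (MvPolynomial (Fin n) k) :=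
  Ideal.span ((fun a => monomial a (1 : k)) '' (sqfree '' (𝒢 : Set (Finset (Fin n)))))

theorem gradedPiece_sqfreeIdeal (𝒢 : Finset (Finset (Fin n))) (e : ℕ) :
    gradedPiece (sqfreeIdeal k 𝒢) e =
      restrictSupport k (idealMonomials Finset.univ 𝒢 e : Set (Fin n →₀ ℕ)) := by
  refine gradedPiece_span_monomial _ _ _ fun u => ?_
  simp [mem_idealMonomials, mem_monomials, sqfree_le_iff]

/-- For squarefree monomial ideals, competing against all homogeneous ideals is the same as
competing against sets of monomials. -/
theorem isGotzmann_sqfreeIdeal_iff (𝒢 : Finset (Finset (Fin n))) :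
    IsGotzmann (sqfreeIdeal k 𝒢) ↔
      ∀ e, MinimalGrowth Finset.univ e (idealMonomials Finset.univ 𝒢 e) := by
  constructor
  · rintro ⟨-, h⟩ e B hB hcard
    have hpiece := gradedPiece_span_monomial (k := k) (B : Set (Fin n →₀ ℕ)) B e fun u => by
      constructor
      · intro hu
        exact ⟨(mem_monomials.1 (hB hu)).1, u, hu, le_rfl⟩
      · rintro ⟨hu, a, ha, hau⟩
        obtain ⟨c, rfl⟩ := exists_add_of_le hau
        have h1 := (mem_monomials.1 (hB ha)).1
        rw [map_add, h1] at hu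
        have : c = 0 := (Finsupp.degree_eq_zero_iff c).1 (by omega)
        simpa [this] using ha
    have := h e _ (isHomogeneous_span_monomial (B : Set (Fin n →₀ ℕ)))
    rw [hpiece, gradedPiece_sqfreeIdeal, mOneMul_restrictSupport, mOneMul_restrictSupport,
      finrank_restrictSupport, finrank_restrictSupport, finrank_restrictSupport,
      finrank_restrictSupport] at this
    exact this hcard.symm
  · intro h
    refine ⟨isHomogeneous_span_monomial _, fun d J _ hdim => ?_⟩
    have hJ : gradedPiece J d ≤ homogeneousSubmodule (Fin n) k d := inf_le_right
    rw [gradedPiece_sqfreeIdeal, finrank_restrictSupport] at hdim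
    rw [gradedPiece_sqfreeIdeal, mOneMul_restrictSupport, finrank_restrictSupport]
    exact (h d _ (leadingMonomials_subset _ _) ((card_leadingMonomials hJ).trans hdim.symm)).trans
      (card_upShadow_leadingMonomials_le hJ)

end Bridge

/-! ### Hilbert functions of squarefree ideals are polynomial in positive degrees -/

/-- The function `f` on `ℕ` is given by a polynomial. -/
def IsPolynomialFunction (f : ℕ → ℚ) : Prop := ∃ P : Polynomial ℚ, ∀ m : ℕ, f m = P.eval (m : ℚ)

theorem IsPolynomialFunction.sub {f g : ℕ → ℚ} (hf : IsPolynomialFunction f)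
    (hg : IsPolynomialFunction g) : IsPolynomialFunction fun m => f m - g m := by
  obtain ⟨P, hP⟩ := hf
  obtain ⟨Q, hQ⟩ := hg
  exact ⟨P - Q, fun m => by rw [Polynomial.eval_sub, ← hP, ← hQ]⟩

theorem IsPolynomialFunction.sum {ι : Type*} (s : Finset ι) {f : ι → ℕ → ℚ}
    (hf : ∀ i ∈ s, IsPolynomialFunction (f i)) :
    IsPolynomialFunction fun m => ∑ i ∈ s, f i m := by
  choose! P hP using hf
  exact ⟨∑ i ∈ s, P i, fun m => by
    rw [Polynomial.eval_finsetSum]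
    exact Finset.sum_congr rfl fun i hi => hP i hi m⟩

theorem isPolynomialFunction_choose (c b : ℕ) :
    IsPolynomialFunction fun m => ((m + c).choose b : ℚ) := by
  refine ⟨Polynomial.C ((b.factorial : ℚ)⁻¹) *
    (descPochhammer ℚ b).comp (Polynomial.X + Polynomial.C (c : ℚ)), fun m => ?_⟩
  have hb : (b.factorial : ℚ) ≠ 0 := Nat.cast_ne_zero.2 b.factorial_ne_zero
  have h := descPochhammer_eval_eq_descFactorial ℚ (m + c) b
  rw [Nat.descFactorial_eq_factorial_mul_choose] at h
  push_cast at h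
  simp only [Polynomial.eval_mul, Polynomial.eval_C, Polynomial.eval_comp, Polynomial.eval_add,
    Polynomial.eval_X]
  rw [h, inv_mul_cancel_left₀ hb]

theorem IsPolynomialFunction.eq_of_eventually_eq {f g : ℕ → ℚ} (hf : IsPolynomialFunction f)
    (hg : IsPolynomialFunction g) {M : ℕ} (h : ∀ m, M ≤ m → f m = g m) (m : ℕ) : f m = g m := by
  obtain ⟨P, hP⟩ := hf
  obtain ⟨Q, hQ⟩ := hg
  have : P = Q := by
    refine Polynomial.eq_of_infinite_eval_eq P Q ?_
    refine Set.Infinite.mono (s := (fun m : ℕ => (m : ℚ)) '' Set.Ici M) ?_ ?_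
    · rintro _ ⟨m, hm, rfl⟩
      simp only [Set.mem_ofPred_eq]
      rw [← hP, ← hQ, h m hm]
    · exact (Set.Ici_infinite M).image Nat.cast_injective.injOn
  rw [hP, hQ, this]

section Hilbert

variable {α : Type*} [DecidableEq α]

theorem isPolynomialFunction_card_support_eq (F : Finset α) :
    IsPolynomialFunction fun m =>
      (((monomials F (m + 1)).filter fun u => u.support = F).card : ℚ) := by
  induction F using Finset.strongInduction with
  | H F ih =>
    -- the monomials in the variables of `F`, sorted by their supports
    have hsum : ∀ m, (((monomials F (m + 1)).filter fun u => u.support = F).card : ℚ) =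
        (F.card.multichoose (m + 1) : ℚ) - ∑ F' ∈ F.ssubsets,
          (((monomials F' (m + 1)).filter fun u => u.support = F').card : ℚ) := by
      intro m
      rw [← card_monomials, Finset.card_eq_sum_card_fiberwise (f := Finsupp.support)
        (t := F.powerset) (fun u hu => Finset.mem_coe.2 (Finset.mem_powerset.2
          (mem_monomials.1 (Finset.mem_coe.1 hu)).2)),
        ← Finset.insert_erase (Finset.mem_powerset_self F),
        Finset.sum_insert (Finset.notMem_erase _ _)]
      push_cast
      rw [eq_sub_iff_add_eq, add_right_inj, ← Finset.ssubsets]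
      refine Finset.sum_congr rfl fun F' hF' => ?_
      congr 2
      ext u
      simp only [Finset.mem_filter, mem_monomials]
      have := (Finset.mem_ssubsets.1 hF').subset
      constructor
      · rintro ⟨⟨h1, h2⟩, h3⟩
        exact ⟨⟨h1, h2.trans this⟩, h3⟩
      · rintro ⟨⟨h1, h2⟩, h3⟩
        exact ⟨⟨h1, h3.subset⟩, h3⟩
    simp only [hsum]
    refine IsPolynomialFunction.sub ?_
      (IsPolynomialFunction.sum _ fun F' hF' => ih F' (Finset.mem_ssubsets.1 hF'))
    rcases F.eq_empty_or_nonempty with rfl | hF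
    · exact ⟨0, fun m => by simp⟩
    · have hpos := Finset.card_pos.2 hF
      obtain ⟨P, hP⟩ := isPolynomialFunction_choose F.card (F.card - 1)
      refine ⟨P, fun m => ?_⟩
      rw [← hP]
      simp only []
      rw [Nat.multichoose_eq, ← Nat.choose_symm_of_eq_add (n := F.card + (m + 1) - 1)
        (a := F.card - 1) (by omega)]
      congr 2
      omega

/-- Membership in a squarefree ideal depends only on the support, and the monomials of positive
degree with a given support are counted by a polynomial. -/
theorem isPolynomialFunction_card_idealMonomials (V : Finset α) (𝒢 : Finset (Finset α)) :
    IsPolynomialFunction fun m => ((idealMonomials V 𝒢 (m + 1)).card : ℚ) := by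
  have hsum : ∀ m, ((idealMonomials V 𝒢 (m + 1)).card : ℚ) =
      ∑ F ∈ V.powerset.filter fun F => ∃ g ∈ 𝒢, g ⊆ F,
        (((monomials F (m + 1)).filter fun u => u.support = F).card : ℚ) := by
    intro m
    rw [Finset.card_eq_sum_card_fiberwise (f := Finsupp.support)
      (t := V.powerset.filter fun F => ∃ g ∈ 𝒢, g ⊆ F) (fun u hu => by
        have hu := mem_idealMonomials.1 (Finset.mem_coe.1 hu)
        exact Finset.mem_coe.2 (Finset.mem_filter.2
          ⟨Finset.mem_powerset.2 (mem_monomials.1 hu.1).2, hu.2⟩))]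
    push_cast
    refine Finset.sum_congr rfl fun F hF => ?_
    obtain ⟨hFV, hF⟩ := Finset.mem_filter.1 hF
    congr 2
    ext u
    simp only [Finset.mem_filter, mem_idealMonomials, mem_monomials]
    constructor
    · rintro ⟨⟨⟨h1, h2⟩, _⟩, h4⟩
      exact ⟨⟨h1, h4.subset⟩, h4⟩
    · rintro ⟨⟨h1, h2⟩, h3⟩
      exact ⟨⟨⟨h1, h2.trans (Finset.mem_powerset.1 hFV)⟩, h3 ▸ hF⟩, h3⟩
  simp only [hsum]
  exact IsPolynomialFunction.sum _ fun F _ => isPolynomialFunction_card_support_eq F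

end Hilbert

/-- The binomial polynomial that counts the monomials of a block generated in degree `a` also
vanishes in the positive degrees below `a`, because `a` is at most the number of
variables of the block. -/
theorem choose_eq_multichoose {n t a m : ℕ} (ht : t < n) (ha : a ≤ n - t) :
    (m + (n - t - a)).choose (n - t - 1) = if a ≤ m + 1 then blockCard n t (m + 1 - a) else 0 := by
  split_ifs with h
  · rw [blockCard_of_lt ht, Nat.multichoose_eq,
      ← Nat.choose_symm_of_eq_add (n := n - t + (m + 1 - a) - 1) (a := n - t - 1) (by omega)]
    congr 1
    omega
  · exact Nat.choose_eq_zero_of_lt (by omega)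

/-- A Macaulay representation is a polynomial in positive degrees, if the blocks generated in higher
degrees are left out, provided that the generating degrees are small enough. -/
theorem isPolynomialFunction_macaulay {n T : ℕ} {d : ℕ → ℕ} (hT : T ≤ n)
    (hdn : ∀ t < T, d t ≤ n - t) (T' : ℕ → ℕ) (hT' : ∀ e, T' e ≤ T)
    (hlow : ∀ e, ∀ t < T' e, d t ≤ e) (hhigh : ∀ e t, T' e ≤ t → t < T → e < d t) :
    IsPolynomialFunction fun m => (macaulay n (m + 1) (T' (m + 1)) d : ℚ) := by
  have hsum : ∀ m, (macaulay n (m + 1) (T' (m + 1)) d : ℚ) =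
      ∑ t ∈ Finset.range T, ((m + (n - t - d t)).choose (n - t - 1) : ℚ) := by
    intro m
    rw [macaulay, ← Nat.cast_sum, Nat.cast_inj, ← Finset.sum_range_add_sum_Ico _ (hT' (m + 1))]
    rw [Finset.sum_eq_zero (s := Finset.Ico _ _), add_zero]
    · refine Finset.sum_congr rfl fun t ht => ?_
      have ht := Finset.mem_range.1 ht
      have htT := ht.trans_le (hT' (m + 1))
      rw [choose_eq_multichoose (by omega) (hdn t htT), if_pos (hlow _ t ht)]
    · intro t ht
      obtain ⟨h1, h2⟩ := Finset.mem_Ico.1 ht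
      rw [choose_eq_multichoose (by omega) (hdn t h2), if_neg (hhigh _ t h1 h2).not_ge]
  simp only [hsum]
  exact IsPolynomialFunction.sum _ fun t _ => isPolynomialFunction_choose _ _

/-! ### Degrees of the generators of squarefree Gotzmann ideals -/

section Generators

variable {α : Type*}

theorem degree_sqfree (g : Finset α) : (sqfree g).degree = g.card := by
  classical
  rw [Finsupp.degree_apply, support_sqfree, Finset.card_eq_sum_ones]
  exact Finset.sum_congr rfl fun i hi => by simp [sqfree_apply, hi]

theorem sqfree_injective : Function.Injective (sqfree : Finset α → α →₀ ℕ) := fun g h hgh => by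
  rw [← support_sqfree g, hgh, support_sqfree]

theorem exists_eq_sqfree_add {g : Finset α} {u : α →₀ ℕ} (h : g ⊆ u.support) :
    ∃ c, u = sqfree g + c := exists_add_of_le (sqfree_le_iff.2 h)

variable [DecidableEq α]

theorem sqfree_mem_monomials {V g : Finset α} (h : g ⊆ V) : sqfree g ∈ monomials V g.card :=
  mem_monomials.2 ⟨degree_sqfree g, by rwa [support_sqfree]⟩

theorem sqfree_mem_idealMonomials {V : Finset α} {𝒢 : Finset (Finset α)} {g : Finset α}
    (hg : g ∈ 𝒢) (h : g ⊆ V) : sqfree g ∈ idealMonomials V 𝒢 g.card :=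
  mem_idealMonomials.2 ⟨sqfree_mem_monomials h, g, hg, by rw [support_sqfree]⟩

theorem upShadow_idealMonomials_subset (V : Finset α) (𝒢 : Finset (Finset α)) (e : ℕ) :
    upShadow V (idealMonomials V 𝒢 e) ⊆ idealMonomials V 𝒢 (e + 1) := by
  intro u hu
  obtain ⟨i, hi, v, hv, rfl⟩ := mem_upShadow.1 hu
  obtain ⟨h1, g, hg, hgv⟩ := mem_idealMonomials.1 hv
  refine mem_idealMonomials.2 ⟨add_single_mem_monomials hi h1, g, hg, ?_⟩
  rw [support_add_single]
  exact hgv.trans (Finset.subset_insert _ _)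

/-- A minimal generator is not a multiple by a variable of a monomial of the ideal. -/
theorem add_single_ne_sqfree {𝒢 : Finset (Finset α)}
    (hanti : ∀ g ∈ 𝒢, ∀ h ∈ 𝒢, g ⊆ h → g = h) {g h : Finset α} (hg : g ∈ 𝒢) (hh : h ∈ 𝒢)
    {v : α →₀ ℕ} {l : α} (hhv : h ⊆ v.support) : v + Finsupp.single l 1 ≠ sqfree g := by
  intro hv
  have h1 : v.support ⊆ g := by
    rw [← support_sqfree g, ← hv, support_add_single]
    exact Finset.subset_insert _ _
  have hl : l ∈ g := by
    rw [← support_sqfree g, ← hv, support_add_single]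
    exact Finset.mem_insert_self _ _
  have := hanti h hh g hg (hhv.trans h1)
  subst this
  have h2 := DFunLike.congr_fun hv l
  have h3 := Finsupp.mem_support_iff.1 (hhv hl)
  simp [sqfree_apply, hl] at h2
  exact h3 h2

/-- The monomials of degree `e + 1` in the ideal are the multiples of those of degree `e` and the
generators of degree `e + 1`. -/
theorem card_idealMonomials_succ {V : Finset α} {𝒢 : Finset (Finset α)} (hV : ∀ g ∈ 𝒢, g ⊆ V)
    (hanti : ∀ g ∈ 𝒢, ∀ h ∈ 𝒢, g ⊆ h → g = h) (e : ℕ) :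
    (idealMonomials V 𝒢 (e + 1)).card =
      (upShadow V (idealMonomials V 𝒢 e)).card + (𝒢.filter fun g => g.card = e + 1).card := by
  rw [← Finset.card_image_of_injective (𝒢.filter fun g => g.card = e + 1) sqfree_injective,
    ← Finset.card_union_of_disjoint]
  · congr 1
    ext u
    rw [Finset.mem_union]
    constructor
    · intro hu
      obtain ⟨h1, g, hg, hgu⟩ := mem_idealMonomials.1 hu
      obtain ⟨c, rfl⟩ := exists_eq_sqfree_add hgu
      obtain ⟨h2, h3⟩ := mem_monomials.1 h1
      by_cases hc : c = 0
      · subst hc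
        rw [add_zero, degree_sqfree] at h2
        right
        rw [add_zero]
        exact Finset.mem_image_of_mem _ (Finset.mem_filter.2 ⟨hg, h2⟩)
      · left
        have hcV : c.support ⊆ V :=
          (Finsupp.support_mono le_add_self).trans h3
        have hdeg : c.degree ≠ 0 := fun h => hc ((Finsupp.degree_eq_zero_iff c).1 h)
        obtain ⟨i, hi, c', hc', rfl⟩ := exists_add_single (e := c.degree - 1) (V := V) (u := c)
          (mem_monomials.2 ⟨by omega, hcV⟩)
        rw [← add_assoc]
        refine add_single_mem_upShadow hi (mem_idealMonomials.2 ⟨mem_monomials.2 ⟨?_, ?_⟩, g, hg,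
          sqfree_le_iff.1 le_self_add⟩)
        · rw [← add_assoc, map_add, Finsupp.degree_single] at h2
          omega
        · rw [← add_assoc] at h3
          exact (Finsupp.support_mono le_self_add).trans h3
    · rintro (hu | hu)
      · exact upShadow_idealMonomials_subset V 𝒢 e hu
      · obtain ⟨g, hg, rfl⟩ := Finset.mem_image.1 hu
        obtain ⟨hg, hge⟩ := Finset.mem_filter.1 hg
        exact hge ▸ sqfree_mem_idealMonomials hg (hV g hg)
  · refine Finset.disjoint_left.2 fun u hu hu' => ?_
    obtain ⟨g, hg, rfl⟩ := Finset.mem_image.1 hu'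
    obtain ⟨i, hi, v, hv, h⟩ := mem_upShadow.1 hu
    obtain ⟨_, g', hg', hgv⟩ := mem_idealMonomials.1 hv
    exact add_single_ne_sqfree hanti (Finset.mem_filter.1 hg).1 hg' hgv h

/-- Removing a generator of degree `e` loses at least its `e` multiples by the variables dividing
it. -/
theorem card_upShadow_erase_add_le {V : Finset α} {𝒢 : Finset (Finset α)}
    (hanti : ∀ g ∈ 𝒢, ∀ h ∈ 𝒢, g ⊆ h → g = h) {g : Finset α} (hg : g ∈ 𝒢) (hV : g ⊆ V) :
    (upShadow V ((idealMonomials V 𝒢 g.card).erase (sqfree g))).card + g.card ≤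
      (upShadow V (idealMonomials V 𝒢 g.card)).card := by
  have hinj : Function.Injective fun i : α => sqfree g + Finsupp.single i 1 := by
    intro i j h
    exact Finsupp.single_left_injective one_ne_zero (add_left_cancel h)
  suffices h : (upShadow V ((idealMonomials V 𝒢 g.card).erase (sqfree g))).card +
      (g.image fun i => sqfree g + Finsupp.single i 1).card ≤
        (upShadow V (idealMonomials V 𝒢 g.card)).card by
    rwa [Finset.card_image_of_injective g hinj] at h
  rw [← Finset.card_union_of_disjoint]
  · refine Finset.card_le_card (Finset.union_subset (upShadow_mono (Finset.erase_subset _ _)) ?_)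
    intro u hu
    obtain ⟨i, hi, rfl⟩ := Finset.mem_image.1 hu
    have hmem := sqfree_mem_idealMonomials hg hV
    exact add_single_mem_upShadow (hV hi) hmem
  · refine Finset.disjoint_left.2 fun u hu hu' => ?_
    obtain ⟨i, hi, rfl⟩ := Finset.mem_image.1 hu'
    obtain ⟨l, hl, v, hv, h⟩ := mem_upShadow.1 hu
    obtain ⟨hne, hv⟩ := Finset.mem_erase.1 hv
    obtain ⟨_, g', hg', hgv⟩ := mem_idealMonomials.1 hv
    by_cases hli : l = i
    · subst hli
      exact hne (add_right_cancel h)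
    · -- `v` is supported in `g` without `l`
      have h1 : v.support ⊆ g := by
        have : v.support ⊆ (sqfree g + Finsupp.single i 1).support := by
          rw [← h, support_add_single]
          exact Finset.subset_insert _ _
        rwa [support_add_single, support_sqfree, Finset.insert_eq_self.2 hi] at this
      have := hanti g' hg' g hg (hgv.trans h1)
      subst this
      have h2 := DFunLike.congr_fun h l
      have hlg : l ∈ g' := by
        by_contra hlg
        simp [sqfree_apply, hlg, hli] at h2
      have h3 := Finsupp.mem_support_iff.1 (hgv hlg)
      simp [sqfree_apply, hlg, hli] at h2
      exact h3 h2

end Generators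

section Degrees

variable {α : Type*} [LinearOrder α]

/-- A nonzero proper squarefree ideal of minimal growth in all degrees has the Hilbert function of a
lexicographic ideal with at most one generator per variable: the same degrees `d t` represent the
Hilbert function in every degree. In large degrees this is the equality case of Macaulay's theorem.
Removing a generator of top degree `E` loses `E` monomials of the next degree, which bounds the
number of blocks, so that both sides are polynomials in all positive degrees. -/
theorem exists_degrees {V : Finset α} {𝒢 : Finset (Finset α)} (hV : ∀ g ∈ 𝒢, g ⊆ V)
    (hanti : ∀ g ∈ 𝒢, ∀ h ∈ 𝒢, g ⊆ h → g = h) (h0 : ∅ ∉ 𝒢) (hne : 𝒢.Nonempty)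
    (hG : ∀ e, MinimalGrowth V e (idealMonomials V 𝒢 e)) :
    ∃ (T : ℕ) (d : ℕ → ℕ) (T' : ℕ → ℕ), Monotone d ∧ T ≤ V.card ∧ (∀ t, 1 ≤ d t) ∧
      (∀ e, T' e ≤ T) ∧ (∀ e, ∀ t < T' e, d t ≤ e) ∧ (∀ e t, T' e ≤ t → t < T → e < d t) ∧
      (∃ E, ∀ e, E ≤ e → T' e = T) ∧
      ∀ e, (idealMonomials V 𝒢 e).card = macaulay V.card e (T' e) d := by
  obtain ⟨g₀, hg₀, hmax⟩ := 𝒢.exists_max_image Finset.card hne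
  set E := g₀.card with hE
  have hE1 : 1 ≤ E := Finset.card_pos.2 (Finset.nonempty_iff_ne_empty.2 fun h => h0 (h ▸ hg₀))
  have hmem := sqfree_mem_idealMonomials hg₀ (hV g₀ hg₀)
  rw [← hE] at hmem
  obtain ⟨T, d, hd, hT, hb, hdT, hN⟩ := exists_macaulay_eq V.card (E - 1)
    (idealMonomials V 𝒢 E).card (Finset.card_pos.2 ⟨_, hmem⟩) (by
      rw [Nat.sub_add_cancel hE1, ← card_monomials]
      exact Finset.card_le_card (idealMonomials_subset _ _ _))
  rw [Nat.sub_add_cancel hE1] at hdT hN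
  have hbE : ∀ t, 1 ≤ d t ∧ d t ≤ E := fun t => by have := hb t; omega
  have hlarge : ∀ e, E ≤ e → (idealMonomials V 𝒢 e).card = macaulay V.card e (T + 1) d := by
    intro e he
    induction e, he using Nat.le_induction with
    | base => exact hN.symm
    | succ e he ih =>
      have hgen : (𝒢.filter fun g => g.card = e + 1) = ∅ :=
        Finset.filter_eq_empty_iff.2 fun g hg h => by
          have := hmax g hg
          omega
      rw [card_idealMonomials_succ hV hanti, hgen, Finset.card_empty, add_zero]
      exact (hG e).card_upShadow (idealMonomials_subset _ _ _) hd
        (fun t _ => ⟨(hbE t).1, (hbE t).2.trans he⟩) ih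
  have hdrop : E ≤ V.card - T := by
    have h1 := card_upShadow_erase_add_le hanti hg₀ (hV g₀ hg₀)
    have h2 : macaulay V.card (E + 1) T d ≤
        (upShadow V ((idealMonomials V 𝒢 E).erase (sqfree g₀))).card := by
      refine macaulay_le_card_upShadow hd (fun t _ => (hbE t).2)
        ((Finset.erase_subset _ _).trans (idealMonomials_subset _ _ _)) ?_
      rw [Finset.card_erase_of_mem hmem, ← hN, macaulay_succ_terms, hdT, Nat.sub_self,
        blockCard_zero_right_of_lt hT]
      simp
    have h3 := (hG E).card_upShadow (idealMonomials_subset _ _ _) hd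
      (fun t (_ : t < T + 1) => hbE t) hN.symm
    rw [macaulay_succ_terms, hdT, Nat.add_sub_cancel_left, blockCard_one_right] at h3
    rw [← hE] at h1
    omega
  have hthr := fun e => exists_threshold (T + 1) hd (e + 1)
  choose T' hT' hlow hhigh using hthr
  have htop : ∀ e, E ≤ e → T' e = T + 1 := by
    intro e he
    by_contra h
    have h1 := hhigh e T (by have := hT' e; omega) (by omega)
    have h2 := (hbE T).2
    omega
  refine ⟨T + 1, d, T', hd, hT, fun t => (hb t).1, hT', fun e t ht =>
    Nat.lt_succ_iff.1 (hlow e t ht), fun e t h1 h2 => hhigh e t h1 h2, ⟨E, htop⟩, ?_⟩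
  rintro (_ | m)
  · have : T' 0 = 0 := by
      by_contra h
      have h1 := hlow 0 0 (Nat.pos_of_ne_zero h)
      have h2 := (hb 0).1
      omega
    rw [this, macaulay_zero_terms, idealMonomials_degree_zero V h0, Finset.card_empty]
  · have h1 := isPolynomialFunction_card_idealMonomials V 𝒢
    have h2 := isPolynomialFunction_macaulay (n := V.card) (T := T + 1) (d := d) hT
      (fun t ht => by have := (hbE t).2; omega) T' hT'
      (fun e t ht => Nat.lt_succ_iff.1 (hlow e t ht)) (fun e t h1 h2 => hhigh e t h1 h2)
    have := h1.eq_of_eventually_eq h2 (M := E) (fun m hm => by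
      rw [hlarge _ (by omega), htop _ (by omega)]) m
    exact_mod_cast this

/-- The growth of the monomials of degree `e + 1` beyond that of the multiples of the monomials of
degree `e`, in terms of the number of generators. -/
theorem card_upShadow_idealMonomials_succ_le {V : Finset α} {𝒢 : Finset (Finset α)}
    (hV : ∀ g ∈ 𝒢, g ⊆ V) (hanti : ∀ g ∈ 𝒢, ∀ h ∈ 𝒢, g ⊆ h → g = h) (h0 : ∅ ∉ 𝒢)
    (hne : 𝒢.Nonempty) (hG : ∀ e, MinimalGrowth V e (idealMonomials V 𝒢 e)) :
    𝒢.card ≤ V.card ∧ ∀ e, (upShadow V (idealMonomials V 𝒢 (e + 1))).card ≤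
      (upShadow V (upShadow V (idealMonomials V 𝒢 e))).card +
        ∑ t ∈ Finset.Ico (𝒢.filter fun g => g.card ≤ e).card
          (𝒢.filter fun g => g.card ≤ e + 1).card, (V.card - t) := by
  obtain ⟨T, d, T', hd, hTn, hd1, hT', hlow, hhigh, ⟨E, hE⟩, hN⟩ :=
    exists_degrees hV hanti h0 hne hG
  have hmono : ∀ e, T' e ≤ T' (e + 1) := by
    intro e
    by_contra! h
    have h1 := hlow e (T' (e + 1)) h
    have h2 := hhigh (e + 1) (T' (e + 1)) le_rfl (h.trans_le (hT' e))
    omega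
  have hblock : ∀ e, ∀ t ∈ Finset.Ico (T' e) (T' (e + 1)), d t = e + 1 := by
    intro e t ht
    obtain ⟨h1, h2⟩ := Finset.mem_Ico.1 ht
    have h3 := hlow (e + 1) t h2
    have h4 := hhigh e t h1 (h2.trans_le (hT' _))
    omega
  have hup : ∀ e, (upShadow V (idealMonomials V 𝒢 e)).card = macaulay V.card (e + 1) (T' e) d :=
    fun e => (hG e).card_upShadow (idealMonomials_subset _ _ _) hd
      (fun t ht => ⟨hd1 t, hlow e t ht⟩) (hN e)
  have hgen : ∀ e, (𝒢.filter fun g => g.card = e + 1).card = T' (e + 1) - T' e := by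
    intro e
    have h1 := card_idealMonomials_succ hV hanti e
    have h2 : ∑ t ∈ Finset.Ico (T' e) (T' (e + 1)), blockCard V.card t (e + 1 - d t) =
        T' (e + 1) - T' e := by
      rw [Finset.sum_congr rfl fun t ht => ?_]
      · rw [← Nat.card_Ico, Finset.card_eq_sum_ones]
      · rw [hblock e t ht, Nat.sub_self]
        exact blockCard_zero_right_of_lt
          (((Finset.mem_Ico.1 ht).2.trans_le (hT' _)).trans_le hTn)
    rw [hN, hup, macaulay_split d (hmono e), h2] at h1
    omega
  have hcount : ∀ e, (𝒢.filter fun g => g.card ≤ e).card = T' e := by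
    intro e
    induction e with
    | zero =>
      have h1 : T' 0 = 0 := by
        by_contra h
        have h1 := hlow 0 0 (Nat.pos_of_ne_zero h)
        have h2 := hd1 0
        omega
      rw [h1, Finset.card_eq_zero, Finset.filter_eq_empty_iff]
      intro g hg h
      exact h0 (Finset.card_eq_zero.1 (Nat.le_zero.1 h) ▸ hg)
    | succ e ih =>
      have : (𝒢.filter fun g => g.card ≤ e + 1) =
          (𝒢.filter fun g => g.card ≤ e) ∪ 𝒢.filter fun g => g.card = e + 1 := by
        rw [← Finset.filter_or]
        exact Finset.filter_congr fun g _ => Nat.le_succ_iff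
      rw [this, Finset.card_union_of_disjoint, ih, hgen]
      · have := hmono e
        omega
      · exact Finset.disjoint_filter.2 fun g _ h1 h2 => by omega
  refine ⟨?_, fun e => ?_⟩
  · set M := max E (𝒢.sup Finset.card) with hM
    have h1 := hcount M
    rw [Finset.filter_true_of_mem fun g hg =>
      (Finset.le_sup (f := Finset.card) hg).trans (le_max_right _ _)] at h1
    rw [h1]
    exact (hT' _).trans hTn
  · have h1 : macaulay V.card (e + 1 + 1) (T' e) d ≤
        (upShadow V (upShadow V (idealMonomials V 𝒢 e))).card :=
      macaulay_le_card_upShadow hd (fun t ht => (hlow e t ht).trans (Nat.le_succ e))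
        (upShadow_subset_monomials (idealMonomials_subset _ _ _)) (hup e).ge
    rw [hup, macaulay_split d (hmono e), hcount, hcount]
    refine Nat.add_le_add h1 (Finset.sum_le_sum fun t ht => ?_)
    rw [hblock e t ht, Nat.add_sub_cancel_left, blockCard_one_right]

end Degrees

/-! ### Minimal growth forces a chain family -/

section Enumeration

variable {α : Type*}

/-- A finite family of sets can be listed in order of size; the listing is continued by its last
member. -/
theorem exists_enumeration (𝒢 : Finset (Finset α)) (hne : 𝒢.Nonempty) :
    ∃ g : ℕ → Finset α, Set.InjOn g (Finset.range 𝒢.card) ∧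
      (∀ h, h ∈ 𝒢 ↔ ∃ t < 𝒢.card, g t = h) ∧ Monotone fun t => (g t).card := by
  set T := 𝒢.card with hT
  have hT1 : 0 < T := Finset.card_pos.2 hne
  let f : Fin T → Finset α := fun i => (𝒢.equivFin.symm i : Finset α)
  have hf : Function.Injective f := Subtype.val_injective.comp 𝒢.equivFin.symm.injective
  have hf' : ∀ h ∈ 𝒢, ∃ i, f i = h := fun h hh => ⟨𝒢.equivFin ⟨h, hh⟩, by simp [f]⟩
  let σ := Tuple.sort fun i => (f i).card
  have hσ : Monotone ((fun i => (f i).card) ∘ σ) := Tuple.monotone_sort _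
  let g : ℕ → Finset α := fun t => f (σ ⟨min t (T - 1), by omega⟩)
  have hg : ∀ t (ht : t < T), g t = f (σ ⟨t, ht⟩) := fun t ht => by
    have : min t (T - 1) = t := by omega
    simp only [g, this]
  refine ⟨g, ?_, fun h => ⟨fun hh => ?_, ?_⟩, ?_⟩
  · intro s hs t ht hst
    have hs := Finset.mem_range.1 (Finset.mem_coe.1 hs)
    have ht := Finset.mem_range.1 (Finset.mem_coe.1 ht)
    rw [hg s hs, hg t ht] at hst
    simpa using σ.injective (hf hst)
  · obtain ⟨i, rfl⟩ := hf' h hh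
    refine ⟨(σ.symm i).1, (σ.symm i).2, ?_⟩
    rw [hg _ (σ.symm i).2]
    simp
  · rintro ⟨t, ht, rfl⟩
    rw [hg t ht]
    exact (𝒢.equivFin.symm _).2
  · intro s t hst
    exact hσ (show (⟨min s (T - 1), by omega⟩ : Fin T) ≤ ⟨min t (T - 1), by omega⟩ from
      Fin.mk_le_mk.2 (by omega))

theorem card_filter_card_le {𝒢 : Finset (Finset α)} {g : ℕ → Finset α}
    (hinj : Set.InjOn g (Finset.range 𝒢.card)) (hg : ∀ h, h ∈ 𝒢 ↔ ∃ t < 𝒢.card, g t = h)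
    (hmono : Monotone fun t => (g t).card) (e : ℕ) :
    (𝒢.filter fun h => h.card ≤ e).card ≤ 𝒢.card ∧
      (∀ t < (𝒢.filter fun h => h.card ≤ e).card, (g t).card ≤ e) ∧
      ∀ t, (𝒢.filter fun h => h.card ≤ e).card ≤ t → t < 𝒢.card → e < (g t).card := by
  classical
  obtain ⟨T₀, hT₀, hlow, hhigh⟩ := exists_threshold 𝒢.card hmono (e + 1)
  have : (𝒢.filter fun h => h.card ≤ e) = (Finset.range T₀).image g := by
    ext h
    simp only [Finset.mem_filter, Finset.mem_image, Finset.mem_range]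
    constructor
    · rintro ⟨hh, hc⟩
      obtain ⟨t, ht, rfl⟩ := (hg h).1 hh
      refine ⟨t, ?_, rfl⟩
      by_contra htT
      have := hhigh t (not_lt.1 htT) ht
      omega
    · rintro ⟨t, ht, rfl⟩
      exact ⟨(hg _).2 ⟨t, ht.trans_le hT₀, rfl⟩, Nat.lt_succ_iff.1 (hlow t ht)⟩
  rw [this, Finset.card_image_of_injOn (hinj.mono (by
    intro t ht
    simp only [Finset.coe_range, Set.mem_Iio] at ht ⊢
    omega)), Finset.card_range]
  exact ⟨hT₀, fun t ht => Nat.lt_succ_iff.1 (hlow t ht), fun t h1 h2 => hhigh t h1 h2⟩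

theorem exists_mem_notMem [Nonempty α] {g : ℕ → Finset α} {t : ℕ} (h : ∀ s < t, ¬ g s ⊆ g t) :
    ∃ c : ℕ → α, ∀ s < t, c s ∈ g s ∧ c s ∉ g t := by
  choose! c hc using fun s (hs : s < t) => Finset.not_subset.1 (h s hs)
  exact ⟨c, hc⟩

end Enumeration

section Colon

variable {α : Type*} [DecidableEq α]

/-- The variables of `V` whose product with the generator `g t` lies in the ideal of the previous
generators. -/
def colonVars (V : Finset α) (g : ℕ → Finset α) (t : ℕ) : Finset α :=
  V.filter fun i => ∃ s ∈ Finset.range t, g s ⊆ insert i (g t)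

theorem mem_colonVars {V : Finset α} {g : ℕ → Finset α} {t : ℕ} {i : α} :
    i ∈ colonVars V g t ↔ i ∈ V ∧ ∃ s < t, g s ⊆ insert i (g t) := by
  simp [colonVars]

theorem colonVars_subset_image {V : Finset α} {g : ℕ → Finset α} {t : ℕ} {c : ℕ → α}
    (hc : ∀ s < t, c s ∈ g s ∧ c s ∉ g t) : colonVars V g t ⊆ (Finset.range t).image c := by
  intro i hi
  obtain ⟨_, s, hs, hsi⟩ := mem_colonVars.1 hi
  obtain ⟨h1, h2⟩ := hc s hs
  exact Finset.mem_image.2 ⟨s, Finset.mem_range.2 hs,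
    (Finset.mem_insert.1 (hsi h1)).resolve_right h2⟩

/-- Each previous generator contributes at most one variable. -/
theorem card_colonVars_le [Nonempty α] {V : Finset α} {g : ℕ → Finset α} {t : ℕ}
    (h : ∀ s < t, ¬ g s ⊆ g t) : (colonVars V g t).card ≤ t := by
  obtain ⟨c, hc⟩ := exists_mem_notMem h
  simpa using (Finset.card_le_card (colonVars_subset_image hc)).trans Finset.card_image_le

/-- The new multiples of the generator `g t` by the variables. -/
noncomputable def newMultiples (V : Finset α) (g : ℕ → Finset α) (t : ℕ) : Finset (α →₀ ℕ) :=
  (V \ colonVars V g t).image fun i => sqfree (g t) + Finsupp.single i 1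

theorem card_newMultiples (V : Finset α) (g : ℕ → Finset α) (t : ℕ) :
    (newMultiples V g t).card = V.card - (colonVars V g t).card := by
  rw [newMultiples, Finset.card_image_of_injective, Finset.card_sdiff_of_subset]
  · exact Finset.filter_subset _ _
  · intro i j h
    exact Finsupp.single_left_injective one_ne_zero (add_left_cancel h)

theorem not_subset_support_of_mem_newMultiples {V : Finset α} {g : ℕ → Finset α} {s t : ℕ}
    (hst : s < t) {u : α →₀ ℕ} (hu : u ∈ newMultiples V g t) : ¬ g s ⊆ u.support := by
  obtain ⟨i, hi, rfl⟩ := Finset.mem_image.1 hu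
  rw [support_add_single, support_sqfree]
  intro h
  exact (Finset.mem_sdiff.1 hi).2 (mem_colonVars.2 ⟨(Finset.mem_sdiff.1 hi).1, s, hst, h⟩)

theorem subset_support_of_mem_newMultiples {V : Finset α} {g : ℕ → Finset α} {t : ℕ}
    {u : α →₀ ℕ} (hu : u ∈ newMultiples V g t) : g t ⊆ u.support := by
  obtain ⟨i, hi, rfl⟩ := Finset.mem_image.1 hu
  rw [support_add_single, support_sqfree]
  exact Finset.subset_insert _ _

theorem disjoint_newMultiples {V : Finset α} {g : ℕ → Finset α} {s t : ℕ} (hst : s ≠ t) :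
    Disjoint (newMultiples V g s) (newMultiples V g t) := by
  refine Finset.disjoint_left.2 fun u hu hu' => ?_
  rcases hst.lt_or_gt with h | h
  · exact not_subset_support_of_mem_newMultiples h hu' (subset_support_of_mem_newMultiples hu)
  · exact not_subset_support_of_mem_newMultiples h hu (subset_support_of_mem_newMultiples hu')

/-- If each of the earlier generators contributes its own variable to the colon ideal, it exceeds
the generator `g t` by exactly that variable. -/
theorem exists_colon_eq [Nonempty α] {V : Finset α} {g : ℕ → Finset α} {t : ℕ}
    (h : ∀ s < t, ¬ g s ⊆ g t) (hcard : (colonVars V g t).card = t) :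
    ∃ c : ℕ → α, Set.InjOn c (Finset.range t) ∧
      ∀ s < t, c s ∈ g s ∧ c s ∉ g t ∧ g s ⊆ insert (c s) (g t) := by
  obtain ⟨c, hc⟩ := exists_mem_notMem h
  have hsub := colonVars_subset_image (V := V) hc
  have hle : ((Finset.range t).image c).card ≤ (colonVars V g t).card := by
    simpa [hcard] using Finset.card_image_le (s := Finset.range t) (f := c)
  have heq := Finset.eq_of_subset_of_card_le hsub hle
  have hinj : Set.InjOn c (Finset.range t) := by
    rw [← Finset.card_image_iff, ← heq, hcard, Finset.card_range]
  refine ⟨c, hinj, fun s hs => ⟨(hc s hs).1, (hc s hs).2, ?_⟩⟩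
  have hmem : c s ∈ colonVars V g t := heq ▸ Finset.mem_image_of_mem c (Finset.mem_range.2 hs)
  obtain ⟨_, s', hs', hsub'⟩ := mem_colonVars.1 hmem
  have h1 := (Finset.mem_insert.1 (hsub' (hc s' hs').1)).resolve_right (hc s' hs').2
  have := hinj (Finset.mem_coe.2 (Finset.mem_range.2 hs')) (Finset.mem_coe.2
    (Finset.mem_range.2 hs)) h1
  exact this ▸ hsub'

end Colon

section Chain

variable {α : Type*} [DecidableEq α]

theorem ChainFamily.image_union {𝒢 : Finset (Finset α)} (h : ChainFamily 𝒢) (D : Finset α)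
    (hD : ∀ g ∈ 𝒢, Disjoint D g) : ChainFamily (𝒢.image (D ∪ ·)) := by
  induction D using Finset.induction_on with
  | empty => simpa using h
  | insert x D hx ih =>
    have := (ih fun g hg => (Finset.disjoint_insert_left.1 (hD g hg)).2).mul x _ (by
      intro g hg
      obtain ⟨g', hg', rfl⟩ := Finset.mem_image.1 hg
      simp [hx, (Finset.disjoint_insert_left.1 (hD g' hg')).1])
    rw [Finset.image_image] at this
    convert this using 2
    ext g
    simp

/-- If every generator exceeds each later one by a single variable, and these variables are
distinct, then the generators form a chain family: the intersections with the last generator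
increase. -/
theorem chainFamily_of_colon {g : ℕ → Finset α} {R : ℕ}
    (hanti : ∀ s ≤ R, ∀ t ≤ R, g s ⊆ g t → s = t)
    (hcolon : ∀ t ≤ R, ∃ c : ℕ → α, Set.InjOn c (Finset.range t) ∧
      ∀ s < t, c s ∈ g s ∧ c s ∉ g t ∧ g s ⊆ insert (c s) (g t)) :
    ChainFamily ((Finset.Icc 0 R).image g) := by
  obtain ⟨c, hinj, hc⟩ := hcolon R le_rfl
  -- `c s` is the variable by which `g s` exceeds every later generator
  have hnot : ∀ s t, s < t → t ≤ R → c s ∉ g t := by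
    intro s t hst htR
    rcases htR.lt_or_eq with htR | rfl
    · intro hmem
      have h1 := (Finset.mem_insert.1 ((hc t htR).2.2 hmem)).resolve_right
        (hc s (hst.trans htR)).2.1
      have := hinj (by simpa using hst.trans htR) (by simpa using htR) h1
      omega
    · exact (hc s hst).2.1
  have hsub : ∀ s t, s < t → t ≤ R → g s ⊆ insert (c s) (g t) := by
    intro s t hst htR
    obtain ⟨c', _, hc'⟩ := hcolon t htR
    have h1 := (Finset.mem_insert.1 ((hc' s hst).2.2 (hc s (hst.trans_le htR)).1)).resolve_right
      (hnot s t hst htR)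
    rw [h1]
    exact (hc' s hst).2.2
  have hD : ∀ s t, s < t → t ≤ R → g s ∩ g R ⊆ g t ∩ g R := by
    intro s t hst htR x hx
    obtain ⟨hx1, hx2⟩ := Finset.mem_inter.1 hx
    refine Finset.mem_inter.2 ⟨(Finset.mem_insert.1 (hsub s t hst htR hx1)).resolve_left ?_, hx2⟩
    rintro rfl
    exact (hc s (hst.trans_le htR)).2.1 hx2
  have key : ∀ k s, s + k = R → ∀ D ⊆ g s ∩ g R,
      ChainFamily ((Finset.Icc s R).image fun j => g j \ D) := by
    intro k
    induction k with
    | zero =>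
      rintro s rfl D _
      have := ChainFamily.unit.image_union (g s \ D) (by simp)
      simpa using this
    | succ k ih =>
      intro s hs D hDs
      have hsR : s < R := by omega
      have h1 := ih (s + 1) (by omega) _ (hD s (s + 1) (by omega) (by omega))
      have h2 := h1.add (c s) _ (by
        intro h
        obtain ⟨j, hj, hj0⟩ := Finset.mem_image.1 h
        have hj := Finset.mem_Icc.1 hj
        have := hanti j hj.2 s hsR.le
          ((Finset.sdiff_eq_empty_iff_subset.1 hj0).trans Finset.inter_subset_left)
        omega) (by
        intro h hh hmem
        obtain ⟨j, hj, rfl⟩ := Finset.mem_image.1 hh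
        have hj := Finset.mem_Icc.1 hj
        exact hnot s j (by omega) hj.2 (Finset.mem_sdiff.1 hmem).1)
      have h3 := h2.image_union ((g s ∩ g R) \ D) (by
        intro h hh
        rcases Finset.mem_insert.1 hh with rfl | hh
        · rw [Finset.disjoint_singleton_right]
          intro h
          exact (hc s hsR).2.1 (Finset.mem_inter.1 (Finset.mem_sdiff.1 h).1).2
        · obtain ⟨j, hj, rfl⟩ := Finset.mem_image.1 hh
          refine Finset.disjoint_left.2 fun x hx hx' => ?_
          exact (Finset.mem_sdiff.1 hx').2 (Finset.mem_sdiff.1 hx).1)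
      convert h3 using 1
      rw [Finset.image_insert, Finset.image_image, ← Finset.insert_Icc_add_one_left_eq_Icc hsR.le,
        Finset.image_insert]
      congr 1
      · -- `g s` is its part in `g R` together with `c s`
        ext x
        have h4 := fun h : x ∈ g s => hsub s R hsR le_rfl h
        have h5 := (hc s hsR).1
        have h6 := fun h : x ∈ D => hDs h
        have h7 := (hc s hsR).2.1
        simp only [Finset.mem_insert, Finset.mem_inter] at h4 h6
        simp only [Finset.mem_sdiff, Finset.mem_union, Finset.mem_inter, Finset.mem_singleton]
        constructor
        · rintro ⟨h8, h9⟩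
          rcases h4 h8 with rfl | h10
          · exact Or.inr rfl
          · exact Or.inl ⟨⟨h8, h10⟩, h9⟩
        · rintro (⟨⟨h8, _⟩, h9⟩ | rfl)
          · exact ⟨h8, h9⟩
          · exact ⟨h5, fun h => h7 (h6 h).2⟩
      · refine Finset.image_congr fun j hj => ?_
        have hj := Finset.mem_Icc.1 (Finset.mem_coe.1 hj)
        ext x
        have h4 := fun h : x ∈ g s ∩ g R => hD s j (by omega) hj.2 h
        have h6 := fun h : x ∈ D => hDs h
        simp only [Finset.mem_inter] at h4 h6
        simp only [Function.comp, Finset.mem_sdiff, Finset.mem_union, Finset.mem_inter]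
        tauto
  simpa using key R 0 (by omega) ∅ (Finset.empty_subset _)

end Chain

/-- Minimal growth in all degrees forces every generator, in order of degree, to have as few new
multiples as the corresponding generator of a lexicographic ideal, which determines the family. -/
theorem chainFamily_of_minimalGrowth {α : Type*} [LinearOrder α] {V : Finset α}
    {𝒢 : Finset (Finset α)} (hV : ∀ g ∈ 𝒢, g ⊆ V)
    (hanti : ∀ g ∈ 𝒢, ∀ h ∈ 𝒢, g ⊆ h → g = h)
    (hG : ∀ e, MinimalGrowth V e (idealMonomials V 𝒢 e)) : ChainFamily 𝒢 := by
  rcases 𝒢.eq_empty_or_nonempty with rfl | hne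
  · exact ChainFamily.zero
  by_cases h0 : ∅ ∈ 𝒢
  · have : 𝒢 = {∅} := Finset.eq_singleton_iff_unique_mem.2
      ⟨h0, fun g hg => (hanti ∅ h0 g hg (Finset.empty_subset g)).symm⟩
    rw [this]
    exact ChainFamily.unit
  have : Nonempty α := by
    obtain ⟨g, hg⟩ := hne
    obtain ⟨x, _⟩ := Finset.nonempty_iff_ne_empty.2 fun h : g = ∅ => h0 (h ▸ hg)
    exact ⟨x⟩
  obtain ⟨hcard, hgrowth⟩ := card_upShadow_idealMonomials_succ_le hV hanti h0 hne hG
  obtain ⟨g, hinj, hg, hmono⟩ := exists_enumeration 𝒢 hne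
  have hmem : ∀ t < 𝒢.card, g t ∈ 𝒢 := fun t ht => (hg _).2 ⟨t, ht, rfl⟩
  have hanti' : ∀ s < 𝒢.card, ∀ t < 𝒢.card, g s ⊆ g t → s = t := fun s hs t ht hst =>
    hinj (by simpa using hs) (by simpa using ht) (hanti _ (hmem s hs) _ (hmem t ht) hst)
  have hns : ∀ t < 𝒢.card, ∀ s < t, ¬ g s ⊆ g t := fun t ht s hs hst => by
    have := hanti' s (hs.trans ht) t ht hst
    omega
  have hcolon : ∀ t < 𝒢.card, (colonVars V g t).card = t := by
    intro t ht
    have hpos : 0 < (g t).card := Finset.card_pos.2 (Finset.nonempty_iff_ne_empty.2 fun h =>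
      h0 (h ▸ hmem t ht))
    obtain ⟨e, he⟩ : ∃ e, (g t).card = e + 1 := ⟨(g t).card - 1, by omega⟩
    obtain ⟨ha1, ha2, ha3⟩ := card_filter_card_le hinj hg hmono e
    obtain ⟨hb1, hb2, hb3⟩ := card_filter_card_le hinj hg hmono (e + 1)
    have hgr := hgrowth e
    set a := (𝒢.filter fun h => h.card ≤ e).card
    set b := (𝒢.filter fun h => h.card ≤ e + 1).card
    have hcardt : ∀ s ∈ Finset.Ico a b, s < 𝒢.card ∧ (g s).card = e + 1 := by
      intro s hs
      obtain ⟨h1, h2⟩ := Finset.mem_Ico.1 hs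
      have h3 := hb2 s h2
      have h4 := ha3 s h1 (by omega)
      omega
    have hsub : upShadow V (upShadow V (idealMonomials V 𝒢 e)) ∪
        (Finset.Ico a b).biUnion (newMultiples V g) ⊆
          upShadow V (idealMonomials V 𝒢 (e + 1)) := by
      refine Finset.union_subset (upShadow_mono (upShadow_idealMonomials_subset V 𝒢 e)) ?_
      intro u hu
      obtain ⟨s, hs, hu⟩ := Finset.mem_biUnion.1 hu
      obtain ⟨hs1, hs2⟩ := hcardt s hs
      obtain ⟨i, hi, rfl⟩ := Finset.mem_image.1 hu
      have := sqfree_mem_idealMonomials (hmem s hs1) (hV _ (hmem s hs1))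
      rw [hs2] at this
      exact add_single_mem_upShadow (Finset.mem_sdiff.1 hi).1 this
    have hdisj : Disjoint (upShadow V (upShadow V (idealMonomials V 𝒢 e)))
        ((Finset.Ico a b).biUnion (newMultiples V g)) := by
      refine Finset.disjoint_left.2 fun u hu hu' => ?_
      obtain ⟨s, hs, hu'⟩ := Finset.mem_biUnion.1 hu'
      obtain ⟨i, _, w, hw, rfl⟩ := mem_upShadow.1 hu
      obtain ⟨j, _, v, hv, rfl⟩ := mem_upShadow.1 hw
      obtain ⟨hv1, h, hh, hhv⟩ := mem_idealMonomials.1 hv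
      -- a generator dividing `v` has degree at most `e`, so it precedes `g s`
      obtain ⟨r, hr, rfl⟩ := (hg h).1 hh
      have hrs : r < s := by
        by_contra hrs
        have h1 : (g s).card ≤ (g r).card := hmono (not_lt.1 hrs)
        have h2 : (g r).card ≤ v.degree := by
          rw [← degree_sqfree]
          exact Finsupp.degree_mono (sqfree_le_iff.2 hhv)
        have h3 := (mem_monomials.1 hv1).1
        have h4 := (hcardt s hs).2
        omega
      refine not_subset_support_of_mem_newMultiples hrs hu' ?_
      rw [support_add_single, support_add_single]
      exact hhv.trans ((Finset.subset_insert _ _).trans (Finset.subset_insert _ _))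
    have hle := Finset.card_le_card hsub
    rw [Finset.card_union_of_disjoint hdisj, Finset.card_biUnion
      fun s _ t _ hst => disjoint_newMultiples hst] at hle
    have hterm : ∀ s ∈ Finset.Ico a b, V.card - s ≤ (newMultiples V g s).card := by
      intro s hs
      rw [card_newMultiples]
      exact Nat.sub_le_sub_left (card_colonVars_le (hns s (hcardt s hs).1)) _
    have hsum : ∑ s ∈ Finset.Ico a b, (V.card - s) =
        ∑ s ∈ Finset.Ico a b, (newMultiples V g s).card :=
      le_antisymm (Finset.sum_le_sum hterm) (by omega)
    have htab : t ∈ Finset.Ico a b := by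
      refine Finset.mem_Ico.2 ⟨?_, ?_⟩
      · by_contra h
        have := ha2 t (by omega)
        omega
      · by_contra h
        have := hb3 t (by omega) ht
        omega
    have h1 := (Finset.sum_eq_sum_iff_of_le hterm).1 hsum t htab
    rw [card_newMultiples] at h1
    have h2 := card_colonVars_le (V := V) (hns t ht)
    omega
  have hT := Finset.card_pos.2 hne
  have := chainFamily_of_colon (g := g) (R := 𝒢.card - 1)
    (fun s hs t ht => hanti' s (by omega) t (by omega))
    fun t ht => exists_colon_eq (hns t (by omega)) (hcolon t (by omega))
  convert this
  ext h
  rw [hg h]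
  simp only [Finset.mem_image, Finset.mem_Icc, Nat.zero_le, true_and]
  constructor
  · rintro ⟨t, ht, rfl⟩
    exact ⟨t, by omega, rfl⟩
  · rintro ⟨t, ht, rfl⟩
    exact ⟨t, by omega, rfl⟩

/-! ### Counting chain families -/

section Count

variable {α : Type*} [DecidableEq α]

theorem ChainFamily.antichain {𝒢 : Finset (Finset α)} (h : ChainFamily 𝒢) :
    ∀ g ∈ 𝒢, ∀ h ∈ 𝒢, g ⊆ h → g = h := by
  induction h with
  | zero => simp
  | unit => simp
  | mul x 𝒢 hx _ ih =>
    intro g hg h hh hgh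
    obtain ⟨g, hg', rfl⟩ := Finset.mem_image.1 hg
    obtain ⟨h, hh', rfl⟩ := Finset.mem_image.1 hh
    rw [ih g hg' h hh' ((Finset.insert_subset_insert_iff (hx g hg')).1 hgh)]
  | add x 𝒢 h0 hx _ ih =>
    intro g hg h hh hgh
    rcases Finset.mem_insert.1 hg with rfl | hg <;> rcases Finset.mem_insert.1 hh with rfl | hh
    · rfl
    · exact absurd (hgh (Finset.mem_singleton_self x)) (hx h hh)
    · rcases Finset.subset_singleton_iff.1 hgh with rfl | rfl
      · exact absurd hg h0
      · rfl
    · exact ih g hg h hh hgh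

theorem ChainFamily.eq_unit {𝒢 : Finset (Finset α)} (h : ChainFamily 𝒢) (h0 : ∅ ∈ 𝒢) :
    𝒢 = {∅} :=
  Finset.eq_singleton_iff_unique_mem.2
    ⟨h0, fun g hg => (h.antichain ∅ h0 g hg (Finset.empty_subset g)).symm⟩

theorem ChainFamily.erase_singleton {𝒢 : Finset (Finset α)} (h : ChainFamily 𝒢) (x : α) :
    ChainFamily (𝒢.erase {x}) := by
  by_cases hx𝒢 : {x} ∈ 𝒢
  swap
  · rwa [Finset.erase_eq_of_notMem hx𝒢]
  induction h with
  | zero => exact ChainFamily.zero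
  | unit =>
    simp at hx𝒢
  | mul y 𝒢 hy h ih =>
    obtain ⟨g, hg, hgx⟩ := Finset.mem_image.1 hx𝒢
    have hyx : y = x := Finset.mem_singleton.1 (hgx ▸ Finset.mem_insert_self y g)
    have hg0 : g = ∅ := by
      refine (Finset.subset_singleton_iff.1 (hgx ▸ Finset.subset_insert y g)).resolve_right ?_
      rintro rfl
      exact hy _ hg (hyx ▸ Finset.mem_singleton_self x)
    have : 𝒢 = {∅} := h.eq_unit (hg0 ▸ hg)
    subst this
    have : (({∅} : Finset (Finset α)).image (insert y)).erase {x} = ∅ := by simp [hyx]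
    rw [this]
    exact ChainFamily.zero
  | add y 𝒢 h0 hy h ih =>
    by_cases hyx : y = x
    · subst hyx
      rwa [Finset.erase_insert fun h => hy _ h (Finset.mem_singleton_self y)]
    · have hne : ({y} : Finset α) ≠ {x} := fun h => hyx (Finset.singleton_injective h)
      rw [Finset.erase_insert_of_ne hne]
      refine (ih ?_).add y _ (fun h => h0 (Finset.mem_of_mem_erase h))
        fun g hg => hy g (Finset.mem_of_mem_erase hg)
      exact (Finset.mem_insert.1 hx𝒢).resolve_left hne.symm

theorem ChainFamily.sdiff_singletons {𝒢 : Finset (Finset α)} (h : ChainFamily 𝒢) (X : Finset α) :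
    ChainFamily (𝒢 \ X.image singleton) := by
  induction X using Finset.induction_on with
  | empty => simpa using h
  | insert x X _ ih =>
    have := ih.erase_singleton x
    rwa [Finset.image_insert, Finset.sdiff_insert]

theorem ChainFamily.union_singletons {𝒢 : Finset (Finset α)} (h : ChainFamily 𝒢) (h0 : ∅ ∉ 𝒢)
    (X : Finset α) (hX : ∀ g ∈ 𝒢, Disjoint X g) : ChainFamily (X.image singleton ∪ 𝒢) := by
  induction X using Finset.induction_on with
  | empty => simpa using h
  | insert x X hx ih =>
    rw [Finset.image_insert, Finset.insert_union]
    refine (ih fun g hg => (Finset.disjoint_insert_left.1 (hX g hg)).2).add x _ ?_ ?_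
    · simp [h0]
    · intro g hg
      rcases Finset.mem_union.1 hg with hg | hg
      · obtain ⟨y, hy, rfl⟩ := Finset.mem_image.1 hg
        rw [Finset.mem_singleton]
        rintro rfl
        exact hx hy
      · exact (Finset.disjoint_insert_left.1 (hX g hg)).1

theorem ChainFamily.image_erase {𝒢 : Finset (Finset α)} (h : ChainFamily 𝒢) (hne : 𝒢.Nonempty)
    {y : α} (hy : ∀ g ∈ 𝒢, y ∈ g) : ChainFamily (𝒢.image (Finset.erase · y)) := by
  induction h with
  | zero => exact absurd hne (by simp)
  | unit => exact absurd (hy ∅ (by simp)) (by simp)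
  | mul x 𝒢 hx h ih =>
    rw [Finset.image_image]
    by_cases hxy : x = y
    · subst hxy
      have : 𝒢.image ((Finset.erase · x) ∘ insert x) = 𝒢 := by
        conv_rhs => rw [← Finset.image_id (s := 𝒢)]
        exact Finset.image_congr fun g hg => Finset.erase_insert (hx g hg)
      rwa [this]
    · have h1 := ih (Finset.image_nonempty.1 hne) fun g hg =>
        Finset.mem_of_mem_insert_of_ne (hy _ (Finset.mem_image_of_mem _ hg)) (Ne.symm hxy)
      have h2 := h1.mul x _ (by
        intro g hg
        obtain ⟨g', hg', rfl⟩ := Finset.mem_image.1 hg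
        exact fun h => hx g' hg' (Finset.mem_of_mem_erase h))
      rw [Finset.image_image] at h2
      convert h2 using 2
      ext g : 1
      exact Finset.erase_insert_of_ne hxy
  | add x 𝒢 h0 hx h ih =>
    have hyx : y = x := Finset.mem_singleton.1 (hy {x} (Finset.mem_insert_self _ _))
    subst hyx
    have : 𝒢 = ∅ := Finset.eq_empty_of_forall_notMem fun g hg =>
      hx g hg (hy g (Finset.mem_insert_of_mem hg))
    subst this
    simpa using ChainFamily.unit

theorem ChainFamily.image_sdiff {𝒢 : Finset (Finset α)} (h : ChainFamily 𝒢) (hne : 𝒢.Nonempty)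
    (Y : Finset α) (hY : ∀ g ∈ 𝒢, Y ⊆ g) : ChainFamily (𝒢.image (· \ Y)) := by
  induction Y using Finset.induction_on with
  | empty => simpa using h
  | insert y Y hy ih =>
    have h1 := (ih fun g hg => (Finset.subset_insert y Y).trans (hY g hg)).image_erase
      (hne.image _) (y := y) (by
        intro g hg
        obtain ⟨g', hg', rfl⟩ := Finset.mem_image.1 hg
        exact Finset.mem_sdiff.2 ⟨hY g' hg' (Finset.mem_insert_self y Y), hy⟩)
    rw [Finset.image_image] at h1
    convert h1 using 2
    ext g : 1
    exact Finset.sdiff_insert _ _ _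

open Classical in
/-- The chain families in the variables of `V`. -/
noncomputable def chainFamilies (V : Finset α) : Finset (Finset (Finset α)) :=
  V.powerset.powerset.filter ChainFamily

theorem mem_chainFamilies {V : Finset α} {𝒢 : Finset (Finset α)} :
    𝒢 ∈ chainFamilies V ↔ (∀ g ∈ 𝒢, g ⊆ V) ∧ ChainFamily 𝒢 := by
  simp [chainFamilies, Finset.subset_iff (s₁ := 𝒢)]

open Classical in
/-- The chain families of proper ideals containing no variable. -/
noncomputable def chainFamiliesNoVar (V : Finset α) : Finset (Finset (Finset α)) :=
  (chainFamilies V).filter fun 𝒢 => ∅ ∉ 𝒢 ∧ ∀ x, {x} ∉ 𝒢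

open Classical in
/-- The chain families of nonzero ideals whose generators have no common variable. -/
noncomputable def chainFamiliesNoFactor (V : Finset α) : Finset (Finset (Finset α)) :=
  (chainFamilies V).filter fun 𝒢 => 𝒢.Nonempty ∧ ∀ x, ∃ g ∈ 𝒢, x ∉ g

theorem mem_chainFamiliesNoVar {V : Finset α} {𝒢 : Finset (Finset α)} :
    𝒢 ∈ chainFamiliesNoVar V ↔
      ((∀ g ∈ 𝒢, g ⊆ V) ∧ ChainFamily 𝒢) ∧ ∅ ∉ 𝒢 ∧ ∀ x, {x} ∉ 𝒢 := by
  simp [chainFamiliesNoVar, mem_chainFamilies]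

theorem mem_chainFamiliesNoFactor {V : Finset α} {𝒢 : Finset (Finset α)} :
    𝒢 ∈ chainFamiliesNoFactor V ↔
      ((∀ g ∈ 𝒢, g ⊆ V) ∧ ChainFamily 𝒢) ∧ 𝒢.Nonempty ∧ ∀ x, ∃ g ∈ 𝒢, x ∉ g := by
  simp [chainFamiliesNoFactor, mem_chainFamilies]

theorem empty_mem_chainFamilies (V : Finset α) : ∅ ∈ chainFamilies V :=
  mem_chainFamilies.2 ⟨by simp, ChainFamily.zero⟩

theorem unit_mem_chainFamilies (V : Finset α) : {∅} ∈ chainFamilies V :=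
  mem_chainFamilies.2 ⟨by simp, ChainFamily.unit⟩

/-- A proper chain ideal is determined by the variables not in it and by an ideal in those that
contains none of them. -/
theorem card_chainFamilies_eq_sum_noVar (V : Finset α) :
    (chainFamilies V).card = 1 + ∑ W ∈ V.powerset, (chainFamiliesNoVar W).card := by
  have hmaps : Set.MapsTo (fun 𝒢 : Finset (Finset α) => V.filter fun x => {x} ∉ 𝒢)
      ((chainFamilies V).erase {∅}) V.powerset :=
    fun _ _ => Finset.mem_coe.2 (Finset.mem_powerset.2 (Finset.filter_subset _ _))
  rw [← Finset.card_erase_add_one (unit_mem_chainFamilies V), add_comm, add_right_inj,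
    Finset.card_eq_sum_card_fiberwise hmaps]
  refine Finset.sum_congr rfl fun W hW => ?_
  have hW := Finset.mem_powerset.1 hW
  refine Finset.card_nbij' (fun 𝒢 => 𝒢 \ (V \ W).image singleton)
    (fun 𝒢 => (V \ W).image singleton ∪ 𝒢) ?_ ?_ ?_ ?_
  · intro 𝒢 h𝒢
    obtain ⟨h1, h2⟩ := Finset.mem_filter.1 (Finset.mem_coe.1 h𝒢)
    obtain ⟨hne, h1⟩ := Finset.mem_erase.1 h1
    obtain ⟨hV, hc⟩ := mem_chainFamilies.1 h1
    have h0 : ∅ ∉ 𝒢 := fun h => hne (hc.eq_unit h)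
    have hsing : ∀ x ∈ V, x ∉ W → {x} ∈ 𝒢 := fun x hx hxW => by
      by_contra h
      exact hxW (h2 ▸ Finset.mem_filter.2 ⟨hx, h⟩)
    refine Finset.mem_coe.2 (mem_chainFamiliesNoVar.2 ⟨⟨fun g hg x hx => ?_,
      hc.sdiff_singletons _⟩, fun h => h0 (Finset.mem_sdiff.1 h).1, fun x hx => ?_⟩)
    · obtain ⟨hg, hg'⟩ := Finset.mem_sdiff.1 hg
      by_contra hxW
      have hxV := hV g hg hx
      have := hc.antichain {x} (hsing x hxV hxW) g hg (by simpa using hx)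
      exact hg' (Finset.mem_image.2 ⟨x, Finset.mem_sdiff.2 ⟨hxV, hxW⟩, this⟩)
    · obtain ⟨hx, hx'⟩ := Finset.mem_sdiff.1 hx
      have hxV : x ∈ V := hV _ hx (Finset.mem_singleton_self x)
      have hxW : x ∈ W := by
        by_contra h
        exact hx' (Finset.mem_image_of_mem _ (Finset.mem_sdiff.2 ⟨hxV, h⟩))
      rw [← h2] at hxW
      exact (Finset.mem_filter.1 hxW).2 hx
  · intro 𝒢 h𝒢
    obtain ⟨⟨hV, hc⟩, h0, hs⟩ := mem_chainFamiliesNoVar.1 (Finset.mem_coe.1 h𝒢)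
    have hdisj : ∀ g ∈ 𝒢, Disjoint (V \ W) g := fun g hg =>
      Finset.disjoint_of_subset_right (hV g hg) Finset.sdiff_disjoint
    refine Finset.mem_coe.2 (Finset.mem_filter.2 ⟨Finset.mem_erase.2 ⟨?_,
      mem_chainFamilies.2 ⟨?_, hc.union_singletons h0 _ hdisj⟩⟩, ?_⟩)
    · intro h
      have h : (V \ W).image singleton ∪ 𝒢 = {∅} := h
      have : ∅ ∈ (V \ W).image singleton ∪ 𝒢 := by
        rw [h]
        exact Finset.mem_singleton_self _
      simp [h0] at this
    · intro g hg
      rcases Finset.mem_union.1 hg with hg | hg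
      · obtain ⟨x, hx, rfl⟩ := Finset.mem_image.1 hg
        simpa using (Finset.mem_sdiff.1 hx).1
      · exact (hV g hg).trans hW
    · ext x
      simp only [Finset.mem_filter, Finset.mem_union, Finset.mem_image, Finset.mem_sdiff,
        Finset.singleton_inj, exists_eq_right, hs x, or_false]
      constructor
      · rintro ⟨h1, h2⟩
        by_contra h
        exact h2 ⟨h1, h⟩
      · exact fun h => ⟨hW h, fun h' => h'.2 h⟩
  · intro 𝒢 h𝒢
    obtain ⟨h1, h2⟩ := Finset.mem_filter.1 (Finset.mem_coe.1 h𝒢)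
    dsimp only
    rw [Finset.union_sdiff_of_subset]
    intro g hg
    obtain ⟨x, hx, rfl⟩ := Finset.mem_image.1 hg
    obtain ⟨hx, hxW⟩ := Finset.mem_sdiff.1 hx
    by_contra h
    exact hxW (h2 ▸ Finset.mem_filter.2 ⟨hx, h⟩)
  · intro 𝒢 h𝒢
    obtain ⟨_, _, hs⟩ := mem_chainFamiliesNoVar.1 (Finset.mem_coe.1 h𝒢)
    dsimp only
    rw [Finset.union_sdiff_cancel_left]
    refine Finset.disjoint_left.2 fun g hg hg' => ?_
    obtain ⟨x, _, rfl⟩ := Finset.mem_image.1 hg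
    exact hs x hg'

/-- A nonzero chain ideal is determined by the variables that are not a common factor and by an
ideal in those without a common factor. -/
theorem card_chainFamilies_eq_sum_noFactor (V : Finset α) :
    (chainFamilies V).card = 1 + ∑ W ∈ V.powerset, (chainFamiliesNoFactor W).card := by
  have hmaps : Set.MapsTo (fun 𝒢 : Finset (Finset α) => V.filter fun x => ∃ g ∈ 𝒢, x ∉ g)
      ((chainFamilies V).erase ∅) V.powerset :=
    fun _ _ => Finset.mem_coe.2 (Finset.mem_powerset.2 (Finset.filter_subset _ _))
  rw [← Finset.card_erase_add_one (empty_mem_chainFamilies V), add_comm, add_right_inj,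
    Finset.card_eq_sum_card_fiberwise hmaps]
  refine Finset.sum_congr rfl fun W hW => ?_
  have hW := Finset.mem_powerset.1 hW
  refine Finset.card_nbij' (fun 𝒢 => 𝒢.image (· \ (V \ W)))
    (fun 𝒢 => 𝒢.image ((V \ W) ∪ ·)) ?_ ?_ ?_ ?_
  · intro 𝒢 h𝒢
    obtain ⟨h1, h2⟩ := Finset.mem_filter.1 (Finset.mem_coe.1 h𝒢)
    obtain ⟨hne, h1⟩ := Finset.mem_erase.1 h1
    obtain ⟨hV, hc⟩ := mem_chainFamilies.1 h1
    have hne := Finset.nonempty_iff_ne_empty.2 hne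
    have hsub : ∀ g ∈ 𝒢, V \ W ⊆ g := fun g hg x hx => by
      obtain ⟨hx, hxW⟩ := Finset.mem_sdiff.1 hx
      by_contra h
      exact hxW (h2 ▸ Finset.mem_filter.2 ⟨hx, g, hg, h⟩)
    refine Finset.mem_coe.2 (mem_chainFamiliesNoFactor.2 ⟨⟨fun g hg x hx => ?_,
      hc.image_sdiff hne _ hsub⟩, hne.image _, fun x => ?_⟩)
    · obtain ⟨g, hg', rfl⟩ := Finset.mem_image.1 hg
      obtain ⟨hx, hx'⟩ := Finset.mem_sdiff.1 hx
      by_contra h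
      exact hx' (Finset.mem_sdiff.2 ⟨hV g hg' hx, h⟩)
    · by_cases hx : x ∈ W
      · rw [← h2] at hx
        obtain ⟨_, g, hg, hxg⟩ := Finset.mem_filter.1 hx
        exact ⟨_, Finset.mem_image_of_mem _ hg, fun h => hxg (Finset.mem_sdiff.1 h).1⟩
      · obtain ⟨g, hg⟩ := hne
        refine ⟨_, Finset.mem_image_of_mem _ hg, fun h => ?_⟩
        obtain ⟨h3, h4⟩ := Finset.mem_sdiff.1 h
        exact h4 (Finset.mem_sdiff.2 ⟨hV g hg h3, hx⟩)
  · intro 𝒢 h𝒢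
    obtain ⟨⟨hV, hc⟩, hne, hs⟩ := mem_chainFamiliesNoFactor.1 (Finset.mem_coe.1 h𝒢)
    have hdisj : ∀ g ∈ 𝒢, Disjoint (V \ W) g := fun g hg =>
      Finset.disjoint_of_subset_right (hV g hg) Finset.sdiff_disjoint
    refine Finset.mem_coe.2 (Finset.mem_filter.2 ⟨Finset.mem_erase.2 ⟨(hne.image _).ne_empty,
      mem_chainFamilies.2 ⟨?_, hc.image_union _ hdisj⟩⟩, ?_⟩)
    · intro g hg
      obtain ⟨g, hg', rfl⟩ := Finset.mem_image.1 hg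
      exact Finset.union_subset Finset.sdiff_subset ((hV g hg').trans hW)
    · ext x
      simp only [Finset.mem_filter, Finset.mem_image, exists_exists_and_eq_and, Finset.mem_union,
        Finset.mem_sdiff, not_or, not_and, not_not]
      constructor
      · rintro ⟨h1, g, _, h2, _⟩
        exact h2 h1
      · intro h
        obtain ⟨g, hg, hxg⟩ := hs x
        exact ⟨hW h, g, hg, fun _ => h, hxg⟩
  · intro 𝒢 h𝒢
    obtain ⟨h1, h2⟩ := Finset.mem_filter.1 (Finset.mem_coe.1 h𝒢)
    dsimp only
    rw [Finset.image_image, Finset.image_congr (g := id) fun g hg => ?_, Finset.image_id]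
    refine Finset.union_sdiff_of_subset fun x hx => ?_
    obtain ⟨hx, hxW⟩ := Finset.mem_sdiff.1 hx
    by_contra h
    exact hxW (h2 ▸ Finset.mem_filter.2 ⟨hx, g, hg, h⟩)
  · intro 𝒢 h𝒢
    obtain ⟨⟨hV, _⟩, _⟩ := mem_chainFamiliesNoFactor.1 (Finset.mem_coe.1 h𝒢)
    dsimp only
    rw [Finset.image_image, Finset.image_congr (g := id) fun g hg => ?_, Finset.image_id]
    exact Finset.union_sdiff_cancel_left
      (Finset.disjoint_of_subset_right (hV g hg) Finset.sdiff_disjoint)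

/-- A chain ideal other than `0` and `1` contains a variable or has a common factor, and both happen
only for the ideals generated by one variable. -/
theorem card_noVar_add_card_noFactor (V : Finset α) :
    (chainFamiliesNoVar V).card + (chainFamiliesNoFactor V).card + V.card =
      (chainFamilies V).card := by
  classical
  have hinter : chainFamiliesNoVar V ∩ chainFamiliesNoFactor V = ∅ := by
    refine Finset.eq_empty_of_forall_notMem fun 𝒢 h𝒢 => ?_
    obtain ⟨h1, h2⟩ := Finset.mem_inter.1 h𝒢
    obtain ⟨⟨_, hc⟩, h0, hs⟩ := mem_chainFamiliesNoVar.1 h1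
    obtain ⟨_, hne, hf⟩ := mem_chainFamiliesNoFactor.1 h2
    cases hc with
    | zero => simp at hne
    | unit => simp at h0
    | mul x 𝒢 hx h =>
      obtain ⟨g, hg, hxg⟩ := hf x
      obtain ⟨g', _, rfl⟩ := Finset.mem_image.1 hg
      exact hxg (Finset.mem_insert_self x g')
    | add x 𝒢 _ hx h => exact hs x (Finset.mem_insert_self _ _)
  have hrest : chainFamilies V \ (chainFamiliesNoVar V ∪ chainFamiliesNoFactor V) =
      V.image fun x => {{x}} := by
    ext 𝒢
    simp only [Finset.mem_sdiff, Finset.mem_union, Finset.mem_image]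
    constructor
    · rintro ⟨h1, h2⟩
      obtain ⟨hV, hc⟩ := mem_chainFamilies.1 h1
      have hne : 𝒢.Nonempty := by
        rw [Finset.nonempty_iff_ne_empty]
        rintro rfl
        exact h2 (Or.inl (mem_chainFamiliesNoVar.2 ⟨⟨hV, hc⟩, by simp, by simp⟩))
      have h0 : ∅ ∉ 𝒢 := fun h => h2 (Or.inr (mem_chainFamiliesNoFactor.2
        ⟨⟨hV, hc⟩, hne, fun x => ⟨∅, h, by simp⟩⟩))
      obtain ⟨x, hx⟩ : ∃ x, {x} ∈ 𝒢 := by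
        by_contra! h
        exact h2 (Or.inl (mem_chainFamiliesNoVar.2 ⟨⟨hV, hc⟩, h0, h⟩))
      obtain ⟨y, hy⟩ : ∃ y, ∀ g ∈ 𝒢, y ∈ g := by
        by_contra! h
        exact h2 (Or.inr (mem_chainFamiliesNoFactor.2 ⟨⟨hV, hc⟩, hne, h⟩))
      have hyx : y = x := Finset.mem_singleton.1 (hy _ hx)
      subst hyx
      refine ⟨y, hV _ hx (Finset.mem_singleton_self y), ?_⟩
      refine (Finset.eq_singleton_iff_unique_mem.2 ⟨hx, fun g hg => ?_⟩).symm
      exact (hc.antichain _ hx g hg (by simpa using hy g hg)).symm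
    · rintro ⟨x, hx, rfl⟩
      refine ⟨mem_chainFamilies.2 ⟨by simpa using hx, ?_⟩, ?_⟩
      · simpa using ChainFamily.zero.add x _ (by simp) (by simp)
      · rintro (h | h)
        · exact (mem_chainFamiliesNoVar.1 h).2.2 x (Finset.mem_singleton_self _)
        · obtain ⟨g, hg, hxg⟩ := (mem_chainFamiliesNoFactor.1 h).2.2 x
          rw [Finset.mem_singleton.1 hg] at hxg
          exact hxg (Finset.mem_singleton_self x)
  have hsub : chainFamiliesNoVar V ∪ chainFamiliesNoFactor V ⊆ chainFamilies V :=
    Finset.union_subset (fun 𝒢 h => mem_chainFamilies.2 (mem_chainFamiliesNoVar.1 h).1)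
      fun 𝒢 h => mem_chainFamilies.2 (mem_chainFamiliesNoFactor.1 h).1
  rw [← Finset.card_union_of_disjoint (Finset.disjoint_iff_inter_eq_empty.2 hinter),
    ← Finset.card_sdiff_add_card_eq_card hsub, hrest, Finset.card_image_of_injective, add_comm]
  exact fun x y h => Finset.singleton_injective (Finset.singleton_injective h)

/-- The two counts have the same sums over the subsets of every set of variables. -/
theorem card_noVar_eq_card_noFactor (V : Finset α) :
    (chainFamiliesNoVar V).card = (chainFamiliesNoFactor V).card := by
  induction V using Finset.strongInduction with
  | H V ih =>
    have h1 := card_chainFamilies_eq_sum_noVar V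
    have h2 := card_chainFamilies_eq_sum_noFactor V
    have h3 := card_noVar_add_card_noFactor V
    rw [← Finset.insert_erase (Finset.mem_powerset_self V),
      Finset.sum_insert (Finset.notMem_erase _ _), ← Finset.ssubsets] at h1 h2
    have h4 := Finset.sum_congr rfl fun W hW => ih W (Finset.mem_ssubsets.1 hW)
    omega

/-- The number of chain families of proper ideals in `n` variables that contain no variable. The
recursion combines the count by the variables outside the ideal with `card_noVar_add_card_noFactor`,
in which the two counts agree. -/
def noVarCount (n : ℕ) : ℤ := 1 - n + ∑ m : Fin n, (n.choose m : ℤ) * noVarCount m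

theorem noVarCount_eq (n : ℕ) :
    noVarCount n = 1 - n + ∑ m ∈ Finset.range n, (n.choose m : ℤ) * noVarCount m := by
  rw [noVarCount, Finset.sum_range]

theorem sum_choose_mul_noVarCount (n : ℕ) :
    ∑ m ∈ Finset.range (n + 1), (n.choose m : ℤ) * noVarCount m = 2 * noVarCount n + n - 1 := by
  rw [Finset.sum_range_succ, Nat.choose_self]
  have := noVarCount_eq n
  push_cast
  linarith

theorem card_chainFamiliesNoVar (V : Finset α) :
    ((chainFamiliesNoVar V).card : ℤ) = noVarCount V.card := by
  induction V using Finset.strongInduction with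
  | H V ih =>
    have h1 := card_chainFamilies_eq_sum_noVar V
    have h2 := card_noVar_add_card_noFactor V
    rw [← card_noVar_eq_card_noFactor] at h2
    rw [← Finset.insert_erase (Finset.mem_powerset_self V),
      Finset.sum_insert (Finset.notMem_erase _ _), ← Finset.ssubsets] at h1
    have h4 : ((∑ W ∈ V.ssubsets, (chainFamiliesNoVar W).card : ℕ) : ℤ) =
        ∑ W ∈ V.ssubsets, noVarCount W.card := by
      push_cast
      exact Finset.sum_congr rfl fun W hW => ih W (Finset.mem_ssubsets.1 hW)
    have h5 : ∑ W ∈ V.powerset, noVarCount W.card = 2 * noVarCount V.card + V.card - 1 := by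
      rw [Finset.sum_powerset_apply_card (fun m => noVarCount m), ← sum_choose_mul_noVarCount]
      simp
    rw [← Finset.insert_erase (Finset.mem_powerset_self V),
      Finset.sum_insert (Finset.notMem_erase _ _), ← Finset.ssubsets] at h5
    omega

/-- Twice the number of ideals containing no variable, and the ideals generated by one variable. -/
theorem card_chainFamilies (V : Finset α) :
    ((chainFamilies V).card : ℤ) = 2 * noVarCount V.card + V.card := by
  rw [← card_noVar_add_card_noFactor, ← card_noVar_eq_card_noFactor]
  push_cast
  rw [card_chainFamiliesNoVar]
  ring

end Count

/-! ### Squarefree monomial ideals and their minimal generators -/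

section Ideals

variable {k : Type*} [Field k] {n : ℕ}

theorem monomial_mem_sqfreeIdeal {𝒢 : Finset (Finset (Fin n))} {u : Fin n →₀ ℕ} :
    monomial u (1 : k) ∈ sqfreeIdeal k 𝒢 ↔ ∃ g ∈ 𝒢, g ⊆ u.support := by
  classical
  simp [sqfreeIdeal, mem_ideal_span_monomial_image, support_monomial, sqfree_le_iff]

theorem isSquarefreeMonomialIdeal_sqfreeIdeal (𝒢 : Finset (Finset (Fin n))) :
    IsSquarefreeMonomialIdeal (sqfreeIdeal k 𝒢) := by
  refine ⟨_, ?_, rfl⟩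
  rintro _ ⟨g, _, rfl⟩ i
  rw [sqfree_apply]
  split_ifs <;> simp

theorem sqfreeIdeal_le_iff {𝒢 ℋ : Finset (Finset (Fin n))} :
    sqfreeIdeal k 𝒢 ≤ sqfreeIdeal k ℋ ↔ ∀ g ∈ 𝒢, ∃ h ∈ ℋ, h ⊆ g := by
  rw [sqfreeIdeal, Ideal.span_le, Set.image_subset_iff, Set.image_subset_iff]
  refine forall₂_congr fun g _ => ?_
  change monomial (sqfree g) (1 : k) ∈ sqfreeIdeal k ℋ ↔ _
  rw [monomial_mem_sqfreeIdeal, support_sqfree]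

/-- The minimal generators of a squarefree monomial ideal are determined by the ideal. -/
theorem subset_of_sqfreeIdeal_eq {𝒢 ℋ : Finset (Finset (Fin n))}
    (h𝒢 : ∀ g ∈ 𝒢, ∀ h ∈ 𝒢, g ⊆ h → g = h) (h : sqfreeIdeal k 𝒢 = sqfreeIdeal k ℋ) : 𝒢 ⊆ ℋ := by
  intro g hg
  obtain ⟨a, ha, hag⟩ := sqfreeIdeal_le_iff.1 h.le g hg
  obtain ⟨b, hb, hba⟩ := sqfreeIdeal_le_iff.1 h.ge a ha
  have hbg := h𝒢 b hb g hg (hba.trans hag)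
  rwa [← hag.antisymm (hbg ▸ hba)]

/-- The minimal supports of squarefree generators suffice. -/
theorem exists_antichain_of_isSquarefreeMonomialIdeal {I : Ideal (MvPolynomial (Fin n) k)}
    (hI : IsSquarefreeMonomialIdeal I) :
    ∃ 𝒢 : Finset (Finset (Fin n)), (∀ g ∈ 𝒢, ∀ h ∈ 𝒢, g ⊆ h → g = h) ∧ I = sqfreeIdeal k 𝒢 := by
  classical
  obtain ⟨A, hA, rfl⟩ := hI
  let ℱ : Finset (Finset (Fin n)) := Finset.univ.filter fun g => sqfree g ∈ A
  have hAℱ : sqfree '' (ℱ : Set (Finset (Fin n))) = A := by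
    ext a
    constructor
    · rintro ⟨g, hg, rfl⟩
      exact (Finset.mem_filter.1 hg).2
    · intro ha
      have : sqfree a.support = a := by
        ext i
        have := hA a ha i
        rw [sqfree_apply]
        split_ifs with h <;> rw [Finsupp.mem_support_iff] at h <;> omega
      exact ⟨a.support, by simp [ℱ, this, ha], this⟩
  refine ⟨ℱ.filter fun g => Minimal (· ∈ ℱ) g, fun g hg h hh hgh => ?_, ?_⟩
  · exact hgh.antisymm ((Finset.mem_filter.1 hh).2.2 (Finset.mem_filter.1 hg).1 hgh)
  · rw [← hAℱ]
    change sqfreeIdeal k ℱ = _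
    refine le_antisymm (sqfreeIdeal_le_iff.2 fun g hg => ?_)
      (sqfreeIdeal_le_iff.2 fun g hg => ⟨g, (Finset.mem_filter.1 hg).1, subset_rfl⟩)
    obtain ⟨h, hhg, hh⟩ := ℱ.exists_le_minimal hg
    exact ⟨h, Finset.mem_filter.2 ⟨hh.1, hh⟩, hhg⟩

variable (k n) in
theorem squarefreeGotzmannIdeals_eq_image :
    squarefreeGotzmannIdeals k n =
      sqfreeIdeal k '' (chainFamilies (Finset.univ : Finset (Fin n))) := by
  ext I
  constructor
  · rintro ⟨hI, hG⟩
    obtain ⟨𝒢, hanti, rfl⟩ := exists_antichain_of_isSquarefreeMonomialIdeal hI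
    have hV : ∀ g ∈ 𝒢, g ⊆ Finset.univ := fun g _ => Finset.subset_univ g
    exact ⟨𝒢, Finset.mem_coe.2 (mem_chainFamilies.2
      ⟨hV, chainFamily_of_minimalGrowth hV hanti ((isGotzmann_sqfreeIdeal_iff 𝒢).1 hG)⟩), rfl⟩
  · rintro ⟨𝒢, h𝒢, rfl⟩
    obtain ⟨hV, hc⟩ := mem_chainFamilies.1 (Finset.mem_coe.1 h𝒢)
    exact ⟨isSquarefreeMonomialIdeal_sqfreeIdeal 𝒢,
      (isGotzmann_sqfreeIdeal_iff 𝒢).2 (hc.minimalGrowth hV)⟩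

variable (k n) in
theorem finite_squarefreeGotzmannIdeals : (squarefreeGotzmannIdeals k n).Finite := by
  rw [squarefreeGotzmannIdeals_eq_image]
  exact (Finset.finite_toSet _).image _

variable (k n) in
theorem ncard_squarefreeGotzmannIdeals :
    ((squarefreeGotzmannIdeals k n).ncard : ℤ) = 2 * noVarCount n + n := by
  have hinj : Set.InjOn (sqfreeIdeal k)
      (chainFamilies (Finset.univ : Finset (Fin n)) : Set (Finset (Finset (Fin n)))) := by
    intro 𝒢 h𝒢 ℋ hℋ h
    have h1 := (mem_chainFamilies.1 (Finset.mem_coe.1 h𝒢)).2.antichain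
    have h2 := (mem_chainFamilies.1 (Finset.mem_coe.1 hℋ)).2.antichain
    exact (subset_of_sqfreeIdeal_eq h1 h).antisymm (subset_of_sqfreeIdeal_eq h2 h.symm)
  rw [squarefreeGotzmannIdeals_eq_image, hinj.ncard_image, Set.ncard_coe_finset,
    card_chainFamilies, Finset.card_univ, Fintype.card_fin]

end Ideals

/-! ### The generating function -/

section GeneratingFunction

/-- The exponential generating function `A` of `noVarCount`. -/
noncomputable def noVarSeries : PowerSeries ℚ :=
  PowerSeries.mk fun n => (noVarCount n : ℚ) / n.factorial

theorem coeff_X_mul_exp (n : ℕ) :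
    PowerSeries.coeff n (PowerSeries.X * PowerSeries.exp ℚ) = (n : ℚ) / n.factorial := by
  cases n with
  | zero => simp
  | succ n =>
    rw [PowerSeries.coeff_succ_X_mul, PowerSeries.coeff_exp, Nat.factorial_succ]
    have : (n.factorial : ℚ) ≠ 0 := by exact_mod_cast n.factorial_ne_zero
    simp
    field_simp

/-- The recurrence for `noVarCount`, as an equation `eᵗ A = 2 A + t eᵗ - eᵗ` of power series. -/
theorem exp_mul_noVarSeries :
    PowerSeries.exp ℚ * noVarSeries =
      2 * noVarSeries + PowerSeries.X * PowerSeries.exp ℚ - PowerSeries.exp ℚ := by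
  ext n
  have hn : (n.factorial : ℚ) ≠ 0 := by exact_mod_cast n.factorial_ne_zero
  rw [mul_comm, PowerSeries.coeff_mul, Finset.Nat.sum_antidiagonal_eq_sum_range_succ_mk, map_sub,
    map_add, coeff_X_mul_exp, two_mul, map_add]
  simp only [noVarSeries, PowerSeries.coeff_mk, PowerSeries.coeff_exp, Algebra.algebraMap_self,
    RingHom.id_apply]
  have h := congrArg (fun z : ℤ => (z : ℚ) / n.factorial) (sum_choose_mul_noVarCount n)
  simp only [Int.cast_sum, Finset.sum_div] at h
  have hterm : ∀ m ∈ Finset.range (n + 1),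
      (noVarCount m : ℚ) / m.factorial * (1 / (n - m).factorial) =
        (((n.choose m : ℤ) * noVarCount m : ℤ) : ℚ) / n.factorial := by
    intro m hm
    have hmn : m ≤ n := Nat.lt_succ_iff.1 (Finset.mem_range.1 hm)
    have h1 : (m.factorial : ℚ) ≠ 0 := by exact_mod_cast m.factorial_ne_zero
    have h2 : ((n - m).factorial : ℚ) ≠ 0 := by exact_mod_cast (n - m).factorial_ne_zero
    push_cast
    rw [Nat.cast_choose ℚ hmn]
    field_simp
  rw [Finset.sum_congr rfl hterm, h]
  push_cast
  field_simp
  ring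

end GeneratingFunction

end SquarefreeGotzmann

open SquarefreeGotzmann in
theorem mainTheorem6 (k : Type*) [Field k] :
    (∀ n : ℕ, (squarefreeGotzmannIdeals k n).Finite) ∧
    exponentialGeneratingFunction (fun n => (squarefreeGotzmannIdeals k n).ncard) =
      PowerSeries.exp ℚ *
        (2 * (1 - PowerSeries.X) * (2 - PowerSeries.exp ℚ)⁻¹ + PowerSeries.X) ∧
    (squarefreeGotzmannIdeals k 0).ncard = 2 ∧
    (squarefreeGotzmannIdeals k 1).ncard = 3 ∧
    (squarefreeGotzmannIdeals k 2).ncard = 6 ∧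
    (squarefreeGotzmannIdeals k 3).ncard = 19 ∧
    (squarefreeGotzmannIdeals k 4).ncard = 96 ∧
    (squarefreeGotzmannIdeals k 5).ncard = 669 := by
  have hcard := ncard_squarefreeGotzmannIdeals k
  have hegf : exponentialGeneratingFunction (fun n => (squarefreeGotzmannIdeals k n).ncard) =
      2 * noVarSeries + PowerSeries.X * PowerSeries.exp ℚ := by
    ext n
    have h : ((squarefreeGotzmannIdeals k n).ncard : ℚ) = 2 * noVarCount n + n := by
      exact_mod_cast hcard n
    rw [two_mul, map_add, map_add, coeff_X_mul_exp, exponentialGeneratingFunction, noVarSeries,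
      PowerSeries.coeff_mk, PowerSeries.coeff_mk, h]
    ring
  -- the inverse is a true one: the constant coefficient of `2 - eᵗ` is `1`
  have hinv : (2 - PowerSeries.exp ℚ) * (2 - PowerSeries.exp ℚ)⁻¹ = 1 := by
    refine PowerSeries.mul_inv_cancel _ ?_
    rw [map_sub, PowerSeries.constantCoeff_exp, map_ofNat]
    norm_num
  have h0 : noVarCount 0 = 1 := by simp [noVarCount_eq 0]
  have h1 : noVarCount 1 = 1 := by simp [noVarCount_eq 1, h0]
  have h2 : noVarCount 2 = 2 := by
    simp [noVarCount_eq 2, Finset.sum_range_succ, h0, h1]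
  have h3 : noVarCount 3 = 8 := by
    simp [noVarCount_eq 3, Finset.sum_range_succ, h0, h1, h2, Nat.choose]
  have h4 : noVarCount 4 = 46 := by
    simp [noVarCount_eq 4, Finset.sum_range_succ, h0, h1, h2, h3, Nat.choose]
  have h5 : noVarCount 5 = 332 := by
    simp [noVarCount_eq 5, Finset.sum_range_succ, h0, h1, h2, h3, h4, Nat.choose]
  refine ⟨finite_squarefreeGotzmannIdeals k, ?_, ?_, ?_, ?_, ?_, ?_, ?_⟩
  · rw [hegf]
    linear_combination (-2 * (2 - PowerSeries.exp ℚ)⁻¹) * exp_mul_noVarSeries -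
      2 * noVarSeries * hinv
  · have := hcard 0
    rw [h0] at this
    omega
  · have := hcard 1
    rw [h1] at this
    omega
  · have := hcard 2
    rw [h2] at this
    omega
  · have := hcard 3
    rw [h3] at this
    omega
  · have := hcard 4
    rw [h4] at this
    omega
  · have := hcard 5
    rw [h5] at this
    omega
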